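/- **Theorem 2 (Consistency of the $\mathbb L_2$-boosting).** Fix $L\ge 1$, $\gamma\in(0,1]$, $0<\xi\le 1$ and $0\le\vartheta<\xi/2$. For every sample size $n$ let $\mathbf X=(X_1,\dots,X_{p_n})$ be a random vector of $\mathbb R^{p_n}$, $p_n\ge 1$, with law $P_{\mathbf X}$ (depending on $n$), let $\langle g,h\rangle=\mathbb E(g(\mathbf X)h(\mathbf X))$ and $\|g\|^2=\langle g,g\rangle$, and for each $i\le p_n$ let $1,\phi^i_1,\dots,\phi^i_L$ be an orthonormal system of $L^2(P_{X_i})$. For $i<j$ let $A^{ij}$ be the $2L\times 2L$ Gram matrix, for $\langle\cdot,\cdot\rangle$, of $(\phi^i_1,\dots,\phi^i_L,\phi^j_1,\dots,\phi^j_L)$, and for $(l,m)\in\{1,\dots,L\}^2$ put $$\phi^{ij}_{(l,m)}=\phi^i_l\,\phi^j_m+\sum_{k=1}^L\lambda^i_k\phi^i_k+\sum_{k=1}^L\lambda^j_k\phi^j_k+c ,$$ where $\lambda=(\lambda^i_1,\dots,\lambda^i_L,\lambda^j_1,\dots,\lambda^j_L)$ solves $A^{ij}\lambda=D$, $D$ being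 minus the vector of inner products of $\phi^i_l\phi^j_m$ with $(\phi^i_1,\dots,\phi^i_L,\phi^j_1,\dots,\phi^j_L)$, and the constant $c$ gives $\phi^{ij}_{(l,m)}(\mathbf X)$ mean zero. Denote by $(\phi^u_{l_u})$, $1\le|u|\le 2$, the family of all these first and second order functions. One observes $n$ i.i.d. copies of $(Y,\mathbf X)$, where $$Y=\tilde f(\mathbf X)+\varepsilon,\qquad \tilde f=\sum_{1\le|u|\le 2}\sum_{l_u}\beta^{u,0}_{l_u}\phi^u_{l_u},$$ $\varepsilon$ is independent of $\mathbf X$, centered, with a law that does not depend on $n$. Split the sample into $\mathcal O_1$ of size $n_1=\lfloor n/2\rfloor$ and $\mathcal O_2$ of size $n_2=n-n_1$. Let $\hat\phi^i_l=\phi^i_l$, and let $\hat\phi^{ij}_{(l,m)}$ be obtained as $\phi^{ij}_{(l,m)}$ is, with all expectations replaced by empirical means over $\mathcal O_1$ (with any solution of the empirical linear system). The $\mathbb L_2$-boosting sets $G_0=0$ and $$G_{k}=G_{k-1}+\gamma\,\langle Y-G_{k-1},\hat\phi_k\rangle_{n_2}\,\hat\phi_k ,$$ where $\langle\cdot,\cdot\rangle_{n_2}$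 is the empirical inner product over $\mathcal O_2$ and $\hat\phi_k$ is any element of the family $(\hat\phi^u_{l_u})$ that maximizes $|\langle Y-G_{k-1},\cdot\rangle_{n_2}|$. Assume: * there is $M<\infty$ with $|\phi^i_l(X_i)|\le M$ almost surely for all $n$, $i\le p_n$, $l\le L$; * $p_n=\mathcal O(\exp(c\,n^{1-\xi}))$ for some $c>0$; * there is $c'>0$ with $\det A^{ij}\ge c' n^{-\vartheta}$ for all $n\ge 1$ and all $i\ne j$ in $\{1,\dots,p_n\}$; * $\mathbb E|\varepsilon|^q<\infty$ for some $q>4/\xi$; * $\sum_{u,l_u}|\beta^{u,0}_{l_u}|$ is bounded uniformly in $n$; * there is $B$ with $\gamma B<2$ and $\|\phi^u_{l_u}\|^2\le B$ for all $n$, $u$, $l_u$ (for example, $\|\phi^u_{l_u}\|\le 1$ for all $n$, $u$, $l_u$). Then, for every $C$ with $0<C<(\xi/2-\vartheta)/(2\log 3)$, with $k_n=\lfloor C\log n\rfloor$ and $\hat f=G_{k_n}$, we have $\|\hat f-\tilde f\|\to 0$ in probability as $n\to+\infty$. -/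

import Mathlib

open MeasureTheory ProbabilityTheory Filter Topology

noncomputable section

/-- Index set of the dictionary of main effects and second order interactions in `p` variables:
`inl (i, l)` stands for `u = {i}` with index `l`, and `inr (⟨(i, j), _⟩, l, m)` stands for
`u = {i, j}`, `i < j`, with multi-index `(l, m)`. The index set `{1, …, L}` is `Fin L`. -/
abbrev DictIdx (p L : ℕ) : Type :=
  (Fin p × Fin L) ⊕ ({ij : Fin p × Fin p // ij.1 < ij.2} × Fin L × Fin L)

/-- `Ψ_0 = 1, Ψ_1, …, Ψ_L` is an orthonormal system of `L²(ℝ, m)`. -/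
structure IsOrthonormalSystem {L : ℕ} (m : Measure ℝ) (Ψ : Fin (L + 1) → ℝ → ℝ) : Prop where
  zero_eq_one : ∀ t, Ψ 0 t = 1
  memLp : ∀ l, MemLp (Ψ l) 2 m
  orthonormal : ∀ l k, ∫ t, Ψ l t * Ψ k t ∂m = if l = k then 1 else 0

/-- The non-constant first order functions `φ_l^i(x_i) = Ψ_l^i(x_i)`, `l = 1, …, L`, seen as
functions of the whole vector `x`. -/
def phiOne {p L : ℕ} (Ψ : Fin p → Fin (L + 1) → ℝ → ℝ) (i : Fin p) (l : Fin L) :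
    (Fin p → ℝ) → ℝ :=
  fun x => Ψ i l.succ (x i)

/-- The vector `(φ_1^i, …, φ_L^i, φ_1^j, …, φ_L^j)`. -/
def pairVec {p L : ℕ} (Ψ : Fin p → Fin (L + 1) → ℝ → ℝ) (i j : Fin p) :
    Fin L ⊕ Fin L → (Fin p → ℝ) → ℝ :=
  Sum.elim (phiOne Ψ i) (phiOne Ψ j)

/-- The Gram matrix `A^{ij}` of `(φ_1^i, …, φ_L^i, φ_1^j, …, φ_L^j)` for the inner product
`⟨g, h⟩ = E (g h)`, where `E` is either the expectation or an empirical mean. -/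
def gramA {p L : ℕ} (E : ((Fin p → ℝ) → ℝ) → ℝ) (Ψ : Fin p → Fin (L + 1) → ℝ → ℝ)
    (i j : Fin p) : Matrix (Fin L ⊕ Fin L) (Fin L ⊕ Fin L) ℝ :=
  Matrix.of fun a b => E fun x => pairVec Ψ i j a x * pairVec Ψ i j b x

/-- The right hand side `D` of the linear system: minus the vector of inner products of
`φ_l^i × φ_m^j` with `(φ_1^i, …, φ_L^i, φ_1^j, …, φ_L^j)`. -/
def rhsD {p L : ℕ} (E : ((Fin p → ℝ) → ℝ) → ℝ) (Ψ : Fin p → Fin (L + 1) → ℝ → ℝ)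
    (i j : Fin p) (l m : Fin L) : Fin L ⊕ Fin L → ℝ :=
  fun a => - E fun x => (phiOne Ψ i l x * phiOne Ψ j m x) * pairVec Ψ i j a x

/-- `φ_l^i(x_i) φ_m^j(x_j) + ∑_k lam_k^i φ_k^i(x_i) + ∑_k lam_k^j φ_k^j(x_j)`. -/
def interUncentered {p L : ℕ} (Ψ : Fin p → Fin (L + 1) → ℝ → ℝ)
    (i j : Fin p) (l m : Fin L) (lam : Fin L ⊕ Fin L → ℝ) : (Fin p → ℝ) → ℝ :=
  fun x => phiOne Ψ i l x * phiOne Ψ j m x + ∑ a, lam a * pairVec Ψ i j a x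

/-- The same function plus the constant `C` that makes its mean `E` equal to zero. -/
def interFun {p L : ℕ} (E : ((Fin p → ℝ) → ℝ) → ℝ) (Ψ : Fin p → Fin (L + 1) → ℝ → ℝ)
    (i j : Fin p) (l m : Fin L) (lam : Fin L ⊕ Fin L → ℝ) : (Fin p → ℝ) → ℝ :=
  fun x => interUncentered Ψ i j l m lam x - E (interUncentered Ψ i j l m lam)

/-- The expectation under the law `μ` of the input vector. -/
def expect {p : ℕ} (μ : Measure (Fin p → ℝ)) : ((Fin p → ℝ) → ℝ) → ℝ :=
  fun h => ∫ x, h x ∂μ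

/-- The mean of the numbers `a r`, `r ∈ I`. -/
def sampleMean (I : Finset ℕ) (a : ℕ → ℝ) : ℝ :=
  (I.card : ℝ)⁻¹ * ∑ r ∈ I, a r

/-- The empirical mean of a function over the points `x r`, `r ∈ I`. -/
def empMean {p : ℕ} (I : Finset ℕ) (x : ℕ → Fin p → ℝ) : ((Fin p → ℝ) → ℝ) → ℝ :=
  fun h => sampleMean I fun r => h (x r)

/-- The theoretical hierarchically orthogonal functions `φ_{l_u}^u`, `1 ≤ |u| ≤ 2`; the
coefficients of a second order function are the solution `(A^{ij})⁻¹ D` of the linear system. -/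
def hofdBasis {p L : ℕ} (μ : Measure (Fin p → ℝ)) (Ψ : Fin p → Fin (L + 1) → ℝ → ℝ) :
    DictIdx p L → (Fin p → ℝ) → ℝ
  | Sum.inl (i, l) => phiOne Ψ i l
  | Sum.inr (ij, l, m) =>
      interFun (expect μ) Ψ ij.1.1 ij.1.2 l m
        ((gramA (expect μ) Ψ ij.1.1 ij.1.2)⁻¹.mulVec (rhsD (expect μ) Ψ ij.1.1 ij.1.2 l m))

/-- `φhat` is an output of the empirical procedure on the points `x r`, `r ∈ I`: first order
functions are kept, and each second order function is built from a solution of the empirical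
linear system (any solution, should the empirical Gram matrix be singular). -/
structure IsEHOFD {p L : ℕ} (I : Finset ℕ) (x : ℕ → Fin p → ℝ)
    (Ψ : Fin p → Fin (L + 1) → ℝ → ℝ) (φhat : DictIdx p L → (Fin p → ℝ) → ℝ) : Prop where
  first_order : ∀ i l, φhat (Sum.inl (i, l)) = phiOne Ψ i l
  second_order : ∀ (ij : {ij : Fin p × Fin p // ij.1 < ij.2}) (l m : Fin L),
    ∃ lam : Fin L ⊕ Fin L → ℝ,
      (gramA (empMean I x) Ψ ij.1.1 ij.1.2).mulVec lam
        = rhsD (empMean I x) Ψ ij.1.1 ij.1.2 l m ∧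
      φhat (Sum.inr (ij, l, m)) = interFun (empMean I x) Ψ ij.1.1 ij.1.2 l m lam

/-- The empirical inner product `⟨Y - g, h⟩` over the observations `(y s, x s)`, `s ∈ I`. -/
def residInner {p : ℕ} (I : Finset ℕ) (x : ℕ → Fin p → ℝ) (y : ℕ → ℝ)
    (g h : (Fin p → ℝ) → ℝ) : ℝ :=
  sampleMean I fun s => (y s - g (x s)) * h (x s)

/-- `G 0, G 1, …` are the successive approximations of a run of `L²`-boosting with shrinkage
parameter `γ` and dictionary `φhat` on the observations `(y s, x s)`, `s ∈ I`. At each step any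
maximizer may be selected. -/
structure IsL2Boosting {p L : ℕ} (γ : ℝ) (I : Finset ℕ) (x : ℕ → Fin p → ℝ) (y : ℕ → ℝ)
    (φhat : DictIdx p L → (Fin p → ℝ) → ℝ) (G : ℕ → (Fin p → ℝ) → ℝ) : Prop where
  init : ∀ t, G 0 t = 0
  step : ∀ k, ∃ v : DictIdx p L,
    (∀ w, |residInner I x y (G k) (φhat w)| ≤ |residInner I x y (G k) (φhat v)|) ∧
    ∀ t, G (k + 1) t = G k t + γ * residInner I x y (G k) (φhat v) * φhat v t

/-- The true signal `∑_u ∑_{l_u} β_{l_u}^u φ_{l_u}^u`. -/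
def signal {p L : ℕ} (μ : Measure (Fin p → ℝ)) (Ψ : Fin p → Fin (L + 1) → ℝ → ℝ)
    (β : DictIdx p L → ℝ) : (Fin p → ℝ) → ℝ :=
  fun x => ∑ v, β v * hofdBasis μ Ψ v x

end

/-! The residual `R j` of the boosting run lives in `L²` of the input law, and its energy `‖R j‖²`
obeys two inequalities. Let `d j` be the largest empirical correlation at step `j`. Up to errors,
one step removes `γ (2 - γ B) (d j)²`, which is where `γ B < 2` enters. Conversely, `R j` is a
combination of dictionary functions whose coefficients have `ℓ¹` norm at most `b j = 1 + K + γ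
∑_{i<j} d i`, so pairing `R j` with its own expansion gives `‖R j‖² ≤ b j * d j` up to errors. The
decrease bounds `∑ (d j)²`, hence `(b j)² = O(1 + j)` by Cauchy–Schwarz. If the energy stayed away
from zero, `(d j)²` would be at least a constant over `1 + j`, against the divergence of the
harmonic series. `inexact_greedy_energy_le` is this scalar argument and
`inexact_boosting_norm_sq_le` its Hilbert space form. The error level `ζ` is only required to make
`ζ * (1 + k)` small: a negative power of `n` against `k` of order `log n`.

Estimating the dictionary costs a single factor `n ^ ϑ`. A theoretical interaction is orthogonal to
its main effects, so the error on its coefficients solves the empirical system with a right-hand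
side of the size of the deviations, and only the inverse Gram matrix amplifies it
(`GramBdd.abs_sub_hofdBasis_le`).

Concentration is needed only for the theoretical dictionary, that is, for fixed functions: a
Bernstein bound and a union over polynomially many functions in `p n` (`withHighProb_sampleMean`),
the noise being truncated at a small power of `n`. On the resulting events the passage to the
estimated dictionary is deterministic (`eLpNorm_boosting_sub_signal_le`). Hence there is no
conditioning on the first half of the sample, and no measurability in `ω` of the estimated
dictionary or of the run is required. -/

/-! ### Greedy approximation in a Hilbert space with inexact inner products. -/

set_option maxHeartbeats 1000000 in
/-- An energy sequence `a` that decreases by `c d²` up to errors, while being controlled by the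
decrements `d` and by their partial sums, is eventually small. -/
theorem inexact_greedy_energy_le {c γ b₀ A κ δ : ℝ} (hc : 0 < c) (hγ : 0 < γ) (hb₀ : 1 ≤ b₀)
    (hA : 0 ≤ A) (hκ : 0 ≤ κ) (hδ : 0 < δ) :
    ∃ N : ℕ, ∃ η : ℝ, 0 < η ∧ ∀ (a d : ℕ → ℝ) (ζ : ℝ) (k : ℕ), N ≤ k → 0 ≤ ζ →
      ζ * (1 + k) ≤ η → (∀ j, 0 ≤ a j) → (∀ j, 0 ≤ d j) → a 0 ≤ A →
      (∀ j, a (j + 1) ≤ a j - c * d j ^ 2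
        + 2 * γ * d j * (ζ * (b₀ + γ * ∑ i ∈ Finset.range j, d i))) →
      (∀ j, a j ≤ A + 1 → a j ≤ (b₀ + γ * ∑ i ∈ Finset.range j, d i)
        * (d j + κ * ζ * (b₀ + γ * ∑ i ∈ Finset.range j, d i))) →
      a k ≤ δ := by
  -- `S` will bound `∑ (d i)²`, and `Q * (1 + j)` will bound `(b j)²`. `N` is chosen so that a
  -- harmonic lower bound on the `(d i)²` exceeds `S`.
  obtain ⟨S, hS⟩ : ∃ S, S = 2 * (A + 1) / c := ⟨_, rfl⟩
  have hS0 : 0 < S := by rw [hS]; positivity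
  obtain ⟨Q, hQ⟩ : ∃ Q, Q = 2 * b₀ ^ 2 + 2 * γ ^ 2 * S := ⟨_, rfl⟩
  have hQ0 : 0 < Q := by rw [hQ]; positivity
  have hQ1 : 1 ≤ Q := by rw [hQ]; nlinarith [mul_pos (pow_pos hγ 2) hS0]
  obtain ⟨N, hN⟩ : ∃ N : ℕ, 16 * Q * S / δ ^ 2 < ∑ i ∈ Finset.range N, (1 : ℝ) / (i + 1) :=
    (Real.tendsto_sum_range_one_div_nat_succ_atTop.eventually_gt_atTop _).exists
  have hm : 0 < min (1 : ℝ) (δ / 2) := lt_min one_pos (by positivity)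
  set T : ℝ := 2 * γ ^ 2 / c * Q with hT
  have hT0 : 0 < T := by positivity
  -- The bound by `1 / T` keeps the accumulated error below `1`, so that energies stay below `A +
  -- 1`. The bound by `δ / 2 / T` keeps the total possible increase of the energy below `δ / 2`. The
  -- last bound makes the correlation error at most `δ / 4`.
  set η : ℝ := min (min 1 (min 1 (δ / 2) / T)) (δ / (4 * Q * (κ + 1))) with hη
  have hη0 : 0 < η := by
    refine lt_min (lt_min one_pos (by positivity)) (by positivity)
  refine ⟨N, η, hη0, fun a d ζ k hNk hζ hζk ha hd ha0 hstep hlow => ?_⟩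
  have hη1 : η ≤ 1 := (min_le_left _ _).trans (min_le_left _ _)
  have hηT : η * T ≤ min 1 (δ / 2) := by
    rw [← le_div_iff₀ hT0]; exact (min_le_left _ _).trans (min_le_right _ _)
  have hηQ : η * (4 * Q * (κ + 1)) ≤ δ := by
    rw [← le_div_iff₀ (by positivity)]; exact min_le_right _ _
  have hk0 : (0 : ℝ) ≤ k := Nat.cast_nonneg k
  set b : ℕ → ℝ := fun j => b₀ + γ * ∑ i ∈ Finset.range j, d i with hb
  have hb1 : ∀ j, 1 ≤ b j := fun j => by
    have : 0 ≤ γ * ∑ i ∈ Finset.range j, d i :=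
      mul_nonneg hγ.le (Finset.sum_nonneg fun i _ => hd i)
    simp only [hb]; linarith
  -- The error of one step, uniform in `j ≤ k`, left after Young's inequality has spent half of the
  -- decrease `c * d j ^ 2`.
  set τ : ℝ := T * ζ ^ 2 * (1 + k) with hτ
  have hτ0 : 0 ≤ τ := by positivity
  have hkτ : k * τ ≤ min 1 (δ / 2) := by
    have h0 : 0 ≤ ζ * (1 + k) := by positivity
    have h1 : (ζ * (1 + k)) ^ 2 ≤ η := by nlinarith
    calc k * τ ≤ T * (ζ * (1 + k)) ^ 2 := by
            rw [hτ]; nlinarith [mul_nonneg hT0.le (mul_nonneg (sq_nonneg ζ) (by linarith : (0:ℝ) ≤ 1 + k))]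
      _ ≤ η * T := by nlinarith
      _ ≤ _ := hηT
  have hbQ : ∀ j, (∑ i ∈ Finset.range j, d i ^ 2) ≤ S → b j ^ 2 ≤ Q * (1 + j) := by
    intro j hj
    have h1 : (∑ i ∈ Finset.range j, d i) ^ 2 ≤ j * S := by
      have := sq_sum_le_card_mul_sum_sq (s := Finset.range j) (f := d)
      rw [Finset.card_range] at this
      exact this.trans (by gcongr)
    have hj0 : (0 : ℝ) ≤ j := Nat.cast_nonneg j
    have h2 : b j ^ 2 ≤ 2 * b₀ ^ 2 + 2 * γ ^ 2 * (∑ i ∈ Finset.range j, d i) ^ 2 := by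
      simp only [hb]; nlinarith [sq_nonneg (b₀ - γ * ∑ i ∈ Finset.range j, d i)]
    have h3 : γ ^ 2 * (∑ i ∈ Finset.range j, d i) ^ 2 ≤ γ ^ 2 * (j * S) := by gcongr
    rw [hQ]
    nlinarith [mul_nonneg hj0 (sq_nonneg b₀), mul_pos (pow_pos hγ 2) hS0]
  have hstep' : ∀ j, j ≤ k → (∑ i ∈ Finset.range j, d i ^ 2) ≤ S →
      a (j + 1) ≤ a j - c / 2 * d j ^ 2 + τ := by
    intro j hjk hj
    have hjk' : (j : ℝ) ≤ k := by exact_mod_cast hjk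
    have h1 : 2 * γ * d j * (ζ * b j) ≤ c / 2 * d j ^ 2 + 2 * γ ^ 2 / c * (ζ ^ 2 * b j ^ 2) := by
      have : 0 ≤ c / 2 * (d j - 2 * γ / c * (ζ * b j)) ^ 2 := by positivity
      have e : c / 2 * (d j - 2 * γ / c * (ζ * b j)) ^ 2 = c / 2 * d j ^ 2
        + 2 * γ ^ 2 / c * (ζ ^ 2 * b j ^ 2) - 2 * γ * d j * (ζ * b j) := by field_simp; ring
      linarith
    have h2 : 2 * γ ^ 2 / c * (ζ ^ 2 * b j ^ 2) ≤ τ := by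
      calc 2 * γ ^ 2 / c * (ζ ^ 2 * b j ^ 2)
          ≤ 2 * γ ^ 2 / c * (ζ ^ 2 * (Q * (1 + k))) := by
            gcongr; exact (hbQ j hj).trans (by gcongr)
        _ = τ := by rw [hτ, hT]; ring
    have := hstep j
    simp only [hb] at h1 h2
    linarith
  -- Energy and `∑ (d i)²` must be bounded together: the step inequality at `j` uses the bound `S`
  -- on the sum, which itself follows from the energy bound at `j`.
  have hmain : ∀ j, j ≤ k → a j + c / 2 * ∑ i ∈ Finset.range j, d i ^ 2 ≤ A + j * τ ∧
      (∑ i ∈ Finset.range j, d i ^ 2) ≤ S := by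
    intro j
    have key : ∀ j : ℕ, j ≤ k → a j + c / 2 * ∑ i ∈ Finset.range j, d i ^ 2 ≤ A + j * τ →
        (∑ i ∈ Finset.range j, d i ^ 2) ≤ S := by
      intro j hjk h
      have h1 : j * τ ≤ 1 := (mul_le_mul_of_nonneg_right (by exact_mod_cast hjk) hτ0).trans
        (hkτ.trans (min_le_left _ _))
      rw [hS, le_div_iff₀ hc]
      linarith [ha j]
    induction j with
    | zero => intro _; simp [ha0, hS0.le]
    | succ j ih =>
      intro hjk
      obtain ⟨h1, h2⟩ := ih (by omega)
      have h3 := hstep' j (by omega) h2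
      have h4 : a (j + 1) + c / 2 * ∑ i ∈ Finset.range (j + 1), d i ^ 2
          ≤ A + ((j + 1 : ℕ) : ℝ) * τ := by
        rw [Finset.sum_range_succ]; push_cast; linarith
      exact ⟨h4, key _ hjk h4⟩
  by_contra! hcon
  -- The energy can rise by at most `τ` per step, so an energy above `δ` at time `k` forces at least
  -- `δ / 2` at every earlier time.
  have hdesc : ∀ i j, j + i ≤ k → a (j + i) ≤ a j + i * τ := by
    intro i
    induction i with
    | zero => intro j _; simp
    | succ i ih =>
      intro j hj
      have h1 := ih j (by omega)
      have h2 := hstep' (j + i) (by omega) (hmain _ (by omega)).2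
      have h3 : 0 ≤ c / 2 * d (j + i) ^ 2 := by positivity
      rw [← add_assoc]; push_cast; linarith
  have haj : ∀ j, j ≤ k → δ / 2 ≤ a j := by
    intro j hj
    have h1 := hdesc (k - j) j (by omega)
    rw [Nat.add_sub_cancel' hj] at h1
    have h2 : ((k - j : ℕ) : ℝ) * τ ≤ k * τ :=
      mul_le_mul_of_nonneg_right (by exact_mod_cast Nat.sub_le k j) hτ0
    linarith [min_le_right (1 : ℝ) (δ / 2)]
  -- From `δ / 2 ≤ b j * d j + δ / 4`, squared, with `(b j)² ≤ Q * (1 + j)`.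
  have hdj : ∀ j, j ≤ k → δ ^ 2 / (16 * Q) * (1 / ((j : ℝ) + 1)) ≤ d j ^ 2 := by
    intro j hj
    have hjk' : (j : ℝ) ≤ k := by exact_mod_cast hj
    obtain ⟨h1, h2⟩ := hmain j hj
    have hAj : a j ≤ A + 1 := by
      have : j * τ ≤ 1 := (mul_le_mul_of_nonneg_right hjk' hτ0).trans
        (hkτ.trans (min_le_left _ _))
      have : 0 ≤ c / 2 * ∑ i ∈ Finset.range j, d i ^ 2 := by positivity
      linarith
    have h3 := hlow j hAj
    change a j ≤ b j * (d j + κ * ζ * b j) at h3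
    have h4 := hbQ j h2
    have h5 : κ * ζ * b j ^ 2 ≤ δ / 4 := by
      calc κ * ζ * b j ^ 2 ≤ κ * ζ * (Q * (1 + k)) := by
            gcongr; exact h4.trans (by gcongr)
        _ = κ * Q * (ζ * (1 + k)) := by ring
        _ ≤ κ * Q * η := by gcongr
        _ ≤ δ / 4 := by nlinarith [mul_pos hη0 hQ0]
    have h6 : δ / 4 ≤ b j * d j := by nlinarith [haj j hj]
    have h7 : (δ / 4) ^ 2 ≤ b j ^ 2 * d j ^ 2 := by
      rw [← mul_pow]; gcongr
    have h8 : b j ^ 2 * d j ^ 2 ≤ Q * (1 + j) * d j ^ 2 := by gcongr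
    rw [div_mul_div_comm, mul_one, div_le_iff₀ (by positivity)]
    nlinarith
  have hsum : δ ^ 2 / (16 * Q) * ∑ i ∈ Finset.range N, (1 : ℝ) / (i + 1) ≤ S := by
    calc δ ^ 2 / (16 * Q) * ∑ i ∈ Finset.range N, (1 : ℝ) / (i + 1)
        = ∑ i ∈ Finset.range N, δ ^ 2 / (16 * Q) * ((1 : ℝ) / (i + 1)) := Finset.mul_sum _ _ _
      _ ≤ ∑ i ∈ Finset.range N, d i ^ 2 := Finset.sum_le_sum fun i hi =>
          hdj i ((Finset.mem_range.1 hi).le.trans hNk)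
      _ ≤ S := (hmain N hNk).2
  have h9 : S < δ ^ 2 / (16 * Q) * ∑ i ∈ Finset.range N, (1 : ℝ) / (i + 1) := by
    calc S = δ ^ 2 / (16 * Q) * (16 * Q * S / δ ^ 2) := by field_simp
      _ < _ := by gcongr
  linarith

/-- Boosting with shrinkage `γ` in a Hilbert space, with inexact inner products `e j w` and an
inexact dictionary `Ψ`, approximates every target whose coefficients in the dictionary `Φ` are
bounded in `ℓ¹` norm. -/
theorem inexact_boosting_norm_sq_le {γ B K δ : ℝ} (hγ : 0 < γ) (hγB : γ * B < 2)
    (hK : 0 ≤ K) (hδ : 0 < δ) :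
    ∃ N : ℕ, ∃ η : ℝ, 0 < η ∧ ∀ (H V : Type) [NormedAddCommGroup H] [InnerProductSpace ℝ H]
      [Fintype V] (Φ Ψ : V → H) (β : V → ℝ) (e : ℕ → V → ℝ) (v : ℕ → V) (R : ℕ → H) (ζ : ℝ)
      (k : ℕ), N ≤ k → 0 ≤ ζ → ζ * (1 + k) ≤ η → ∑ w, |β w| ≤ K → (∀ w, ‖Ψ w‖ ^ 2 ≤ B) →
      (∀ w, ‖Φ w - Ψ w‖ ≤ ζ) → R 0 = ∑ w, β w • Φ w →
      (∀ j, R (j + 1) = R j - (γ * e j (v j)) • Ψ (v j)) →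
      (∀ j w, |e j w| ≤ |e j (v j)|) →
      (∀ j w, |e j w - inner ℝ (R j) (Ψ w)|
        ≤ ζ * (1 + K + γ * ∑ i ∈ Finset.range j, |e i (v i)|)) →
      ‖R k‖ ^ 2 ≤ δ := by
  -- The initial residual has `ℓ¹` norm at most `K` in functions of norm at most `√B + ζ ≤ √B + 1`.
  obtain ⟨A, hA⟩ : ∃ A, A = (K * (√B + 1)) ^ 2 := ⟨_, rfl⟩
  have hA0 : 0 ≤ A := by rw [hA]; positivity
  -- In `κ`, the `1` pays for the inexact inner products and `√(A + 1)`, a bound for `‖R j‖`, pays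
  -- for replacing `Φ` by `Ψ`.
  obtain ⟨N, η, hη, H⟩ := inexact_greedy_energy_le (c := γ * (2 - γ * B)) (γ := γ) (b₀ := 1 + K)
    (A := A) (κ := 1 + √(A + 1)) (δ := δ) (by nlinarith) hγ (by linarith) hA0 (by positivity) hδ
  refine ⟨N, min η 1, by positivity, ?_⟩
  intro E V _ _ _ Φ Ψ β e v R ζ k hNk hζ hζk hβ hΨ hΦΨ hR0 hR hmax herr
  have hk0 : (0 : ℝ) ≤ k := Nat.cast_nonneg k
  have hζ1 : ζ ≤ 1 := by nlinarith [min_le_right η 1]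
  have hΨ' : ∀ w, ‖Ψ w‖ ≤ √B := fun w => Real.le_sqrt_of_sq_le (hΨ w)
  have hΦ : ∀ w, ‖Φ w‖ ≤ √B + 1 := fun w => by
    calc ‖Φ w‖ = ‖Ψ w + (Φ w - Ψ w)‖ := by simp
      _ ≤ _ := (norm_add_le _ _).trans (add_le_add (hΨ' w) ((hΦΨ w).trans hζ1))
  set d : ℕ → ℝ := fun j => |e j (v j)| with hd
  set b : ℕ → ℝ := fun j => 1 + K + γ * ∑ i ∈ Finset.range j, d i with hb
  have hb1 : ∀ j, 1 ≤ b j := fun j => by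
    have : 0 ≤ γ * ∑ i ∈ Finset.range j, d i :=
      mul_nonneg hγ.le (Finset.sum_nonneg fun i _ => abs_nonneg _)
    simp only [hb]; linarith
  have hinner : ∀ j w, |inner ℝ (R j) (Ψ w)| ≤ d j + ζ * b j := fun j w => by
    have h1 := herr j w
    have h2 := hmax j w
    have h3 := abs_sub_abs_le_abs_sub (inner ℝ (R j) (Ψ w)) (e j w)
    rw [abs_sub_comm] at h3
    simp only [hb, hd]; linarith
  have hRsum : ∀ j, R j = ∑ w, β w • Φ w - ∑ i ∈ Finset.range j, (γ * e i (v i)) • Ψ (v i) := by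
    intro j
    induction j with
    | zero => simp [hR0]
    | succ j ih => rw [hR, ih, Finset.sum_range_succ]; abel
  refine H (fun j => ‖R j‖ ^ 2) d ζ k hNk hζ (hζk.trans (min_le_left _ _))
    (fun j => by positivity) (fun j => abs_nonneg _) ?_ ?_ ?_
  · have : ‖R 0‖ ≤ K * (√B + 1) := by
      rw [hR0]
      calc ‖∑ w, β w • Φ w‖ ≤ ∑ w, ‖β w • Φ w‖ := norm_sum_le _ _
        _ ≤ ∑ w, |β w| * (√B + 1) := Finset.sum_le_sum fun w _ => by
            rw [norm_smul, Real.norm_eq_abs]; gcongr; exact hΦ w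
        _ ≤ _ := by rw [← Finset.sum_mul]; gcongr
    rw [hA]; gcongr
  · intro j
    have h1 : ‖R (j + 1)‖ ^ 2 = ‖R j‖ ^ 2 - 2 * (γ * e j (v j)) * inner ℝ (R j) (Ψ (v j))
        + (γ * e j (v j)) ^ 2 * ‖Ψ (v j)‖ ^ 2 := by
      rw [hR, norm_sub_sq_real, inner_smul_right, norm_smul, mul_pow, Real.norm_eq_abs, sq_abs]
      ring
    have h2 : (γ * e j (v j)) ^ 2 * ‖Ψ (v j)‖ ^ 2 ≤ (γ * e j (v j)) ^ 2 * B := by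
      gcongr; exact hΨ _
    have h3 : e j (v j) * (e j (v j) - inner ℝ (R j) (Ψ (v j))) ≤ d j * (ζ * b j) := by
      refine (le_abs_self _).trans ?_
      rw [abs_mul]; gcongr; exact herr j _
    have h4 : d j ^ 2 = e j (v j) ^ 2 := sq_abs _
    change ‖R (j + 1)‖ ^ 2 ≤ ‖R j‖ ^ 2 - γ * (2 - γ * B) * d j ^ 2 + 2 * γ * d j * (ζ * b j)
    rw [h1, h4]
    nlinarith
  · intro j hj
    change ‖R j‖ ^ 2 ≤ b j * (d j + (1 + √(A + 1)) * ζ * b j)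
    have hRj : ‖R j‖ ≤ √(A + 1) := Real.le_sqrt_of_sq_le hj
    have hpos : 0 ≤ d j + ζ * b j + √(A + 1) * ζ := by
      have := hb1 j; positivity
    -- Only one of the two factors `R j` is expanded. Each term is then a correlation with a
    -- dictionary element, controlled by the maximal one.
    have h1 : ‖R j‖ ^ 2 = ∑ w, β w * inner ℝ (R j) (Φ w)
        - ∑ i ∈ Finset.range j, (γ * e i (v i)) * inner ℝ (R j) (Ψ (v i)) := by
      rw [← real_inner_self_eq_norm_sq]
      conv_lhs => enter [3]; rw [hRsum j]
      rw [inner_sub_right, inner_sum, inner_sum]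
      simp only [inner_smul_right]
    have h2 : ∑ w, β w * inner ℝ (R j) (Φ w) ≤ K * (d j + ζ * b j + √(A + 1) * ζ) := by
      calc ∑ w, β w * inner ℝ (R j) (Φ w)
          ≤ ∑ w, |β w| * (d j + ζ * b j + √(A + 1) * ζ) := Finset.sum_le_sum fun w _ => by
            refine (le_abs_self _).trans ?_
            rw [abs_mul]
            gcongr
            have : inner ℝ (R j) (Φ w) = inner ℝ (R j) (Ψ w) + inner ℝ (R j) (Φ w - Ψ w) := by
              rw [← inner_add_right]; simp
            rw [this]
            refine (abs_add_le _ _).trans (add_le_add (hinner j w) ?_)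
            refine (abs_real_inner_le_norm _ _).trans ?_
            gcongr; exact hΦΨ w
        _ ≤ _ := by rw [← Finset.sum_mul]; gcongr
    have h3 : -∑ i ∈ Finset.range j, (γ * e i (v i)) * inner ℝ (R j) (Ψ (v i))
        ≤ (γ * ∑ i ∈ Finset.range j, d i) * (d j + ζ * b j + √(A + 1) * ζ) := by
      rw [← Finset.sum_neg_distrib, Finset.mul_sum, Finset.sum_mul]
      refine Finset.sum_le_sum fun i _ => (le_abs_self _).trans ?_
      rw [abs_neg, abs_mul, abs_mul, abs_of_pos hγ]
      gcongr
      exact (hinner j _).trans (le_add_of_nonneg_right (by positivity))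
    have h4 : ‖R j‖ ^ 2 ≤ b j * (d j + ζ * b j + √(A + 1) * ζ) := by
      simp only [hb] at hpos h2 h3 ⊢
      rw [h1]; linarith
    refine h4.trans ?_
    have := hb1 j
    refine mul_le_mul_of_nonneg_left ?_ (by linarith)
    have h5 : √(A + 1) * ζ * 1 ≤ √(A + 1) * ζ * b j := by gcongr
    linarith

/-! ### Exponential concentration of empirical means. -/

/-- A centered variable bounded by `1 / t` has a sub-Gaussian Laplace transform at `t`. -/
theorem integral_exp_mul_le_exp_sq_mul {S : Type*} [MeasurableSpace S] {ρ : Measure S}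
    [IsProbabilityMeasure ρ] {g : S → ℝ} {b s t : ℝ} (hg : AEMeasurable g ρ)
    (hgb : ∀ᵐ x ∂ρ, |g x| ≤ b) (hg0 : ∫ x, g x ∂ρ = 0) (hgs : ∫ x, g x ^ 2 ∂ρ ≤ s)
    (ht : 0 ≤ t) (htb : t * b ≤ 1) :
    ∫ x, Real.exp (t * g x) ∂ρ ≤ Real.exp (t ^ 2 * s) := by
  have hint : Integrable g ρ := Integrable.of_bound hg.aestronglyMeasurable b (by simpa using hgb)
  have hint2 : Integrable (fun x => g x ^ 2) ρ := by
    refine Integrable.of_bound (hg.pow_const 2).aestronglyMeasurable (b ^ 2) ?_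
    filter_upwards [hgb] with x hx
    rw [Real.norm_eq_abs, abs_pow]; gcongr
  -- `exp u ≤ 1 + u + u²` for `|u| ≤ 1`, and the linear term integrates to zero.
  calc ∫ x, Real.exp (t * g x) ∂ρ ≤ ∫ x, (1 + t * g x + t ^ 2 * g x ^ 2) ∂ρ := by
        refine integral_mono_of_nonneg (Eventually.of_forall fun x => (Real.exp_pos _).le)
          (((integrable_const _).add (hint.const_mul _)).add (hint2.const_mul _)) ?_
        filter_upwards [hgb] with x hx
        have h1 : |t * g x| ≤ 1 := by
          rw [abs_mul, abs_of_nonneg ht]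
          exact (mul_le_mul_of_nonneg_left hx ht).trans htb
        have := le_of_abs_le (Real.abs_exp_sub_one_sub_id_le h1)
        nlinarith
    _ = 1 + t ^ 2 * ∫ x, g x ^ 2 ∂ρ := by
        have h1 : Integrable (fun x => 1 + t * g x) ρ := (integrable_const _).add (hint.const_mul _)
        rw [integral_add h1 (hint2.const_mul _),
          integral_add (integrable_const _) (hint.const_mul _), integral_const_mul,
          integral_const_mul, hg0]
        simp
    _ ≤ 1 + t ^ 2 * s := by gcongr
    _ ≤ Real.exp (t ^ 2 * s) := by rw [add_comm]; exact Real.add_one_le_exp _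

section Concentration

variable {Ω S : Type*} [MeasurableSpace Ω] [MeasurableSpace S] {P : Measure Ω}
  [IsProbabilityMeasure P] {ρ : Measure S} [IsProbabilityMeasure ρ] {n : ℕ} {Z : ℕ → Ω → S}
  {I : Finset ℕ}

/-- One-sided Bernstein type inequality for bounded centered variables. -/
theorem measure_sum_ge_le_of_bounded (hlaw : ∀ r, r < n → HasLaw (Z r) ρ P)
    (hindep : iIndepFun (fun (r : Fin n) ω => Z r ω) P) (hI : ∀ r ∈ I, r < n)
    {g : S → ℝ} {b s t a : ℝ} (hg : AEMeasurable g ρ) (hgb : ∀ᵐ x ∂ρ, |g x| ≤ b)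
    (hg0 : ∫ x, g x ∂ρ = 0) (hgs : ∫ x, g x ^ 2 ∂ρ ≤ s) (ht : 0 ≤ t) (htb : t * b ≤ 1)
    (hta : 2 * (t * s) ≤ a) :
    P {ω | I.card * a ≤ ∑ r ∈ I, g (Z r ω)}
      ≤ ENNReal.ofReal (Real.exp (-(I.card * (t * a) / 2))) := by
  have hlawI : ∀ r : I, HasLaw (Z r) ρ P := fun r => hlaw r (hI r r.2)
  have hgI : ∀ r : I, AEMeasurable g (P.map (Z r)) := fun r => by rwa [(hlawI r).map_eq]
  have hX : ∀ r : I, AEMeasurable (g ∘ Z r) P := fun r =>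
    (hgI r).comp_aemeasurable (hlawI r).aemeasurable
  have hind : iIndepFun (fun (r : I) => g ∘ Z r) P :=
    (hindep.precomp (g := fun r : I => (⟨r, hI r r.2⟩ : Fin n)) (fun r r' h => by
      exact Subtype.ext (congrArg Fin.val h))).comp₀ (fun _ => g) (fun r => (hlawI r).aemeasurable) hgI
  have hexp : ∀ r : I, mgf (g ∘ Z r) P t = ∫ x, Real.exp (t * g x) ∂ρ := fun r => by
    have := (hlawI r).integral_comp (f := fun x => Real.exp (t * g x))
      (hg.const_mul t).exp.aestronglyMeasurable
    exact this
  have hsum : ∀ ω, (∑ r : I, g ∘ Z r) ω = ∑ r ∈ I, g (Z r ω) := fun ω => by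
    rw [Finset.sum_apply, ← Finset.sum_coe_sort I (fun r => g (Z r ω))]; rfl
  have hbd : ∀ᵐ ω ∂P, ∀ r : I, |g (Z r ω)| ≤ b := by
    refine ae_all_iff.2 fun r => ?_
    rw [← (hlawI r).map_eq] at hgb
    exact ae_of_ae_map (hlawI r).aemeasurable hgb
  have hint : Integrable (fun ω => Real.exp (t * (∑ r : I, g ∘ Z r) ω)) P := by
    refine Integrable.of_bound (C := Real.exp (t * (I.card * b)))
      ((Finset.aemeasurable_sum _ fun r _ => hX r).const_mul t).exp.aestronglyMeasurable ?_
    filter_upwards [hbd] with ω hω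
    rw [Real.norm_eq_abs, Real.abs_exp, hsum, ← nsmul_eq_mul]
    gcongr
    exact Finset.sum_le_card_nsmul _ _ _ fun r hr => (le_abs_self _).trans (hω ⟨r, hr⟩)
  have h := measure_ge_le_exp_mul_mgf (μ := P) (I.card * a) ht hint
  rw [hind.mgf_sum₀ hX] at h
  simp only [hexp, Finset.prod_const, Finset.card_univ, Fintype.card_coe, hsum] at h
  rw [← ofReal_measureReal]
  refine ENNReal.ofReal_le_ofReal (h.trans ?_)
  calc Real.exp (-t * (I.card * a)) * (∫ x, Real.exp (t * g x) ∂ρ) ^ I.card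
      ≤ Real.exp (-t * (I.card * a)) * Real.exp (t ^ 2 * s) ^ I.card := by
        gcongr
        exact integral_exp_mul_le_exp_sq_mul hg hgb hg0 hgs ht htb
    _ = Real.exp (-(I.card * (t * a)) + I.card * (t * (t * s))) := by
        rw [← Real.exp_nat_mul, ← Real.exp_add]; ring_nf
    _ ≤ _ := by
        gcongr
        -- The variance term uses up at most half of the exponent.
        have h1 : t * (2 * (t * s)) ≤ t * a := by gcongr
        have h2 : (0 : ℝ) ≤ I.card := Nat.cast_nonneg _
        nlinarith

/-- Uniform deviations of empirical means over a finite family of bounded functions. -/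
theorem measure_exists_sampleMean_sub_ge_le (hlaw : ∀ r, r < n → HasLaw (Z r) ρ P)
    (hindep : iIndepFun (fun (r : Fin n) ω => Z r ω) P) (hI : ∀ r ∈ I, r < n)
    (hI0 : 0 < I.card) {W : Type*} [Fintype W] {f : W → S → ℝ} {b s t a : ℝ}
    (hf : ∀ w, AEMeasurable (f w) ρ) (hfb : ∀ w, ∀ᵐ x ∂ρ, |f w x| ≤ b)
    (hfs : ∀ w, ∫ x, f w x ^ 2 ∂ρ ≤ s) (ht : 0 ≤ t) (htb : t * (2 * b) ≤ 1)
    (hta : 2 * (t * s) ≤ a) :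
    P {ω | ∃ w, a ≤ |sampleMean I (fun r => f w (Z r ω)) - ∫ x, f w x ∂ρ|}
      ≤ ENNReal.ofReal (2 * Fintype.card W * Real.exp (-(I.card * (t * a) / 2))) := by
  have hIpos : (0 : ℝ) < I.card := by exact_mod_cast hI0
  have hint : ∀ w, Integrable (f w) ρ := fun w =>
    Integrable.of_bound (hf w).aestronglyMeasurable b (by simpa using hfb w)
  have hint2 : ∀ w, Integrable (fun x => f w x ^ 2) ρ := fun w => by
    refine Integrable.of_bound ((hf w).pow_const 2).aestronglyMeasurable (b ^ 2) ?_
    filter_upwards [hfb w] with x hx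
    rw [Real.norm_eq_abs, abs_pow]; gcongr
  have hone : ∀ w, P {ω | a ≤ |sampleMean I (fun r => f w (Z r ω)) - ∫ x, f w x ∂ρ|}
      ≤ ENNReal.ofReal (2 * Real.exp (-(I.card * (t * a) / 2))) := by
    intro w
    set m := ∫ x, f w x ∂ρ with hm
    have hmb : |m| ≤ b := by
      have := norm_integral_le_of_norm_le_const (μ := ρ) (f := f w) (C := b) (by simpa using hfb w)
      simpa using this
    have hg0 : ∫ x, (f w x - m) ∂ρ = 0 := by
      rw [integral_sub (hint w) (integrable_const _)]; simp [hm]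
    have hgs : ∫ x, (f w x - m) ^ 2 ∂ρ ≤ s := by
      have : ∫ x, (f w x - m) ^ 2 ∂ρ = ∫ x, f w x ^ 2 ∂ρ - m ^ 2 := by
        have e : ∀ x, (f w x - m) ^ 2 = f w x ^ 2 - 2 * m * f w x + m ^ 2 := fun x => by ring
        simp only [e]
        have h1 : Integrable (fun x => f w x ^ 2 - 2 * m * f w x) ρ :=
          (hint2 w).sub ((hint w).const_mul _)
        rw [integral_add h1 (integrable_const _),
          integral_sub (hint2 w) ((hint w).const_mul _), integral_const_mul, ← hm]
        simp; ring
      rw [this]; linarith [hfs w, sq_nonneg m]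
    have hgb : ∀ᵐ x ∂ρ, |f w x - m| ≤ 2 * b := by
      filter_upwards [hfb w] with x hx
      exact (abs_sub _ _).trans (by linarith)
    have h1 := measure_sum_ge_le_of_bounded hlaw hindep hI ((hf w).sub_const m) hgb hg0 hgs ht htb hta
    have h2 := measure_sum_ge_le_of_bounded hlaw hindep hI (g := fun x => -(f w x - m))
      ((hf w).sub_const m).neg (by simpa only [abs_neg] using hgb) (by rw [integral_neg, hg0, neg_zero])
      (by simpa only [neg_sq] using hgs) ht htb hta
    have hsub : {ω | a ≤ |sampleMean I (fun r => f w (Z r ω)) - m|} ⊆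
        {ω | I.card * a ≤ ∑ r ∈ I, (f w (Z r ω) - m)}
          ∪ {ω | I.card * a ≤ ∑ r ∈ I, -(f w (Z r ω) - m)} := by
      intro ω hω
      have e : I.card * (sampleMean I (fun r => f w (Z r ω)) - m) = ∑ r ∈ I, (f w (Z r ω) - m) := by
        rw [Finset.sum_sub_distrib, Finset.sum_const, nsmul_eq_mul, sampleMean, mul_sub,
          mul_inv_cancel_left₀ hIpos.ne']
      simp only [Set.mem_union, Set.mem_ofPred_eq, Finset.sum_neg_distrib, ← e, ← mul_neg] at hω ⊢
      rcases le_abs.1 hω with h | h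
      · left; gcongr
      · right; gcongr
    refine (measure_mono hsub).trans ((measure_union_le _ _).trans ((add_le_add h1 h2).trans ?_))
    rw [← ENNReal.ofReal_add (Real.exp_pos _).le (Real.exp_pos _).le, two_mul]
  have hU : {ω | ∃ w, a ≤ |sampleMean I (fun r => f w (Z r ω)) - ∫ x, f w x ∂ρ|} =
      ⋃ w ∈ (Finset.univ : Finset W),
        {ω | a ≤ |sampleMean I (fun r => f w (Z r ω)) - ∫ x, f w x ∂ρ|} := by
    ext ω; simp
  rw [hU]
  refine (measure_biUnion_finset_le _ _).trans ((Finset.sum_le_sum fun w _ => hone w).trans ?_)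
  rw [Finset.sum_const, Finset.card_univ, nsmul_eq_mul, ← ENNReal.ofReal_natCast,
    ← ENNReal.ofReal_mul (Nat.cast_nonneg _)]
  exact ENNReal.ofReal_le_ofReal (le_of_eq (by ring))

end Concentration

/-! ### Elementary properties of empirical means. -/

section SampleMean

variable {I : Finset ℕ}

theorem sampleMean_add (a b : ℕ → ℝ) :
    sampleMean I (fun r => a r + b r) = sampleMean I a + sampleMean I b := by
  simp only [sampleMean, Finset.sum_add_distrib, mul_add]

theorem sampleMean_sub (a b : ℕ → ℝ) :
    sampleMean I (fun r => a r - b r) = sampleMean I a - sampleMean I b := by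
  simp only [sampleMean, Finset.sum_sub_distrib, mul_sub]

theorem sampleMean_const_mul (c : ℝ) (a : ℕ → ℝ) :
    sampleMean I (fun r => c * a r) = c * sampleMean I a := by
  simp only [sampleMean, ← Finset.mul_sum, mul_left_comm]

theorem sampleMean_sum {ι : Type*} (s : Finset ι) (a : ι → ℕ → ℝ) :
    sampleMean I (fun r => ∑ i ∈ s, a i r) = ∑ i ∈ s, sampleMean I (a i) := by
  simp only [sampleMean, Finset.mul_sum]
  exact Finset.sum_comm

theorem sampleMean_const (hI : 0 < I.card) (c : ℝ) : sampleMean I (fun _ => c) = c := by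
  have : (I.card : ℝ) ≠ 0 := by exact_mod_cast hI.ne'
  simp [sampleMean, this]

theorem sampleMean_mono {a b : ℕ → ℝ} (h : ∀ r ∈ I, a r ≤ b r) :
    sampleMean I a ≤ sampleMean I b :=
  mul_le_mul_of_nonneg_left (Finset.sum_le_sum h) (by positivity)

theorem sampleMean_congr {a b : ℕ → ℝ} (h : ∀ r ∈ I, a r = b r) :
    sampleMean I a = sampleMean I b := by
  rw [sampleMean, sampleMean, Finset.sum_congr rfl h]

theorem abs_sampleMean_le (a : ℕ → ℝ) : |sampleMean I a| ≤ sampleMean I (fun r => |a r|) := by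
  rw [sampleMean, sampleMean, abs_mul, abs_of_nonneg (by positivity)]
  gcongr
  exact Finset.abs_sum_le_sum_abs _ _

theorem abs_sampleMean_le_of_le (hI : 0 < I.card) {a : ℕ → ℝ} {b : ℝ} (h : ∀ r ∈ I, |a r| ≤ b) :
    |sampleMean I a| ≤ b :=
  (abs_sampleMean_le a).trans ((sampleMean_mono h).trans_eq (sampleMean_const hI b))

end SampleMean

/-! ### Quantitative invertibility of matrices. -/

section Matrix

variable {ι : Type*} [Fintype ι]

/-- A matrix with bounded entries and determinant bounded below is bounded below. -/
theorem norm_le_mul_norm_mulVec_of_le_det [DecidableEq ι] {A : Matrix ι ι ℝ} {x κ : ℝ} (hx : 1 ≤ x)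
    (hA : ∀ a b, |A a b| ≤ x) (hκ : 0 < κ) (hdet : κ ≤ A.det) (v : ι → ℝ) :
    ‖v‖ ≤ Fintype.card ι * ((Fintype.card ι).factorial * x ^ Fintype.card ι) / κ
      * ‖A.mulVec v‖ := by
  have hd : 0 < A.det := hκ.trans_le hdet
  -- A cofactor is the determinant after one row is replaced by a unit vector; since `1 ≤ x`, all
  -- entries remain bounded by `x`, and the Leibniz expansion applies.
  have hadj : ∀ a b, |A.adjugate a b| ≤ (Fintype.card ι).factorial * x ^ Fintype.card ι := by
    intro a b
    rw [Matrix.adjugate_apply]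
    have := Matrix.det_le (A := A.updateRow b (Pi.single a 1)) (abv := AbsoluteValue.abs)
      (x := x) (fun i j => by
        rw [Matrix.updateRow_apply]
        split_ifs
        · by_cases h : j = a
          · subst h; simpa using hx
          · simp [Pi.single_eq_of_ne h]; linarith
        · exact hA i j)
    simpa [nsmul_eq_mul] using this
  have hv : A.det • v = A.adjugate.mulVec (A.mulVec v) := by
    rw [Matrix.mulVec_mulVec, Matrix.adjugate_mul, Matrix.smul_mulVec, Matrix.one_mulVec]
  rw [pi_norm_le_iff_of_nonneg (by positivity)]
  intro a
  have h1 : A.det * |v a| ≤ Fintype.card ι * ((Fintype.card ι).factorial * x ^ Fintype.card ι)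
      * ‖A.mulVec v‖ := by
    have h2 : A.det * v a = ∑ b, A.adjugate a b * A.mulVec v b := by
      have := congrFun hv a
      simpa [Matrix.mulVec, dotProduct] using this
    calc A.det * |v a| = |∑ b, A.adjugate a b * A.mulVec v b| := by
          rw [← h2, abs_mul, abs_of_pos hd]
      _ ≤ ∑ b, |A.adjugate a b * A.mulVec v b| := Finset.abs_sum_le_sum_abs _ _
      _ ≤ ∑ _b : ι, ((Fintype.card ι).factorial * x ^ Fintype.card ι) * ‖A.mulVec v‖ :=
          Finset.sum_le_sum fun b _ => by
            rw [abs_mul]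
            exact mul_le_mul (hadj a b) (norm_le_pi_norm (A.mulVec v) b) (abs_nonneg _)
              (by positivity)
      _ = _ := by rw [Finset.sum_const, Finset.card_univ, nsmul_eq_mul]; ring
  rw [Real.norm_eq_abs, div_mul_eq_mul_div, le_div_iff₀ hκ]
  calc |v a| * κ ≤ |v a| * A.det := by gcongr
    _ ≤ _ := by rw [mul_comm]; exact h1

/-- Being bounded below is stable under small perturbations of the entries. -/
theorem norm_le_mul_norm_mulVec_of_perturbation {A A' : Matrix ι ι ℝ} {Λ t : ℝ} (hΛ : 0 ≤ Λ)
    (hA : ∀ v : ι → ℝ, ‖v‖ ≤ Λ * ‖A.mulVec v‖) (hAA' : ∀ a b, |A' a b - A a b| ≤ t)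
    (ht : 0 ≤ t) (hsmall : Λ * (Fintype.card ι * t) ≤ 1 / 2) (v : ι → ℝ) :
    ‖v‖ ≤ 2 * Λ * ‖A'.mulVec v‖ := by
  have h1 : ‖(A' - A).mulVec v‖ ≤ Fintype.card ι * t * ‖v‖ := by
    rw [pi_norm_le_iff_of_nonneg (by positivity)]
    intro a
    calc ‖(A' - A).mulVec v a‖ ≤ ∑ b, |(A' - A) a b * v b| := Finset.abs_sum_le_sum_abs _ _
      _ ≤ ∑ _b : ι, t * ‖v‖ := Finset.sum_le_sum fun b _ => by
          rw [abs_mul]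
          exact mul_le_mul (hAA' a b) (norm_le_pi_norm v b) (abs_nonneg _) ht
      _ = _ := by rw [Finset.sum_const, Finset.card_univ, nsmul_eq_mul]; ring
  have h2 : ‖A.mulVec v‖ ≤ ‖A'.mulVec v‖ + ‖(A' - A).mulVec v‖ := by
    have : A.mulVec v = A'.mulVec v - (A' - A).mulVec v := by rw [Matrix.sub_mulVec]; abel
    rw [this]; exact norm_sub_le _ _
  have h3 := hA v
  have h4 : Λ * ‖A.mulVec v‖ ≤ Λ * (‖A'.mulVec v‖ + Fintype.card ι * t * ‖v‖) := by
    gcongr; exact h2.trans (by gcongr)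
  have h5 : Λ * (Fintype.card ι * t) * ‖v‖ ≤ 1 / 2 * ‖v‖ := by gcongr
  nlinarith

end Matrix

/-! ### Theoretical and estimated dictionaries. -/

section Dictionary

variable {p L : ℕ} {μ : Measure (Fin p → ℝ)} {Ψ : Fin p → Fin (L + 1) → ℝ → ℝ}

theorem pairVec_eq_phiOne (i j : Fin p) (a : Fin L ⊕ Fin L) :
    pairVec Ψ i j a = phiOne Ψ (Sum.elim (fun _ => i) (fun _ => j) a) (Sum.elim id id a) := by
  cases a <;> rfl

theorem aestronglyMeasurable_phiOne
    (hΨ : ∀ i, IsOrthonormalSystem (μ.map fun x => x i) (Ψ i)) (i : Fin p) (l : Fin L) :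
    AEStronglyMeasurable (phiOne Ψ i l) μ :=
  ((hΨ i).memLp l.succ).1.comp_measurable (measurable_pi_apply i)

theorem integral_phiOne (hΨ : ∀ i, IsOrthonormalSystem (μ.map fun x => x i) (Ψ i))
    (i : Fin p) (l : Fin L) : ∫ x, phiOne Ψ i l x ∂μ = 0 := by
  have h := (hΨ i).orthonormal l.succ 0
  simp only [(hΨ i).zero_eq_one, mul_one, Fin.succ_ne_zero, if_false] at h
  rw [integral_map (measurable_pi_apply i).aemeasurable ((hΨ i).memLp l.succ).1] at h
  exact h

theorem aestronglyMeasurable_pairVec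
    (hΨ : ∀ i, IsOrthonormalSystem (μ.map fun x => x i) (Ψ i)) (i j : Fin p)
    (a : Fin L ⊕ Fin L) : AEStronglyMeasurable (pairVec Ψ i j a) μ := by
  rw [pairVec_eq_phiOne]; exact aestronglyMeasurable_phiOne hΨ _ _

theorem aestronglyMeasurable_interUncentered
    (hΨ : ∀ i, IsOrthonormalSystem (μ.map fun x => x i) (Ψ i)) (i j : Fin p) (l m : Fin L)
    (lam : Fin L ⊕ Fin L → ℝ) : AEStronglyMeasurable (interUncentered Ψ i j l m lam) μ := by
  unfold interUncentered
  refine ((aestronglyMeasurable_phiOne hΨ i l).mul (aestronglyMeasurable_phiOne hΨ j m)).add ?_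
  exact Finset.aestronglyMeasurable_fun_sum _ fun a _ =>
    (aestronglyMeasurable_pairVec hΨ i j a).const_mul _

theorem aestronglyMeasurable_interFun
    (hΨ : ∀ i, IsOrthonormalSystem (μ.map fun x => x i) (Ψ i)) (E : ((Fin p → ℝ) → ℝ) → ℝ)
    (i j : Fin p) (l m : Fin L) (lam : Fin L ⊕ Fin L → ℝ) :
    AEStronglyMeasurable (interFun E Ψ i j l m lam) μ :=
  (aestronglyMeasurable_interUncentered hΨ i j l m lam).sub aestronglyMeasurable_const

theorem aestronglyMeasurable_hofdBasis
    (hΨ : ∀ i, IsOrthonormalSystem (μ.map fun x => x i) (Ψ i)) (v : DictIdx p L) :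
    AEStronglyMeasurable (hofdBasis μ Ψ v) μ := by
  match v with
  | Sum.inl (i, l) => exact aestronglyMeasurable_phiOne hΨ i l
  | Sum.inr (ij, l, m) => exact aestronglyMeasurable_interFun hΨ _ _ _ _ _ _

theorem IsEHOFD.aestronglyMeasurable {I : Finset ℕ} {x : ℕ → Fin p → ℝ}
    {φhat : DictIdx p L → (Fin p → ℝ) → ℝ}
    (hΨ : ∀ i, IsOrthonormalSystem (μ.map fun x => x i) (Ψ i)) (h : IsEHOFD I x Ψ φhat)
    (v : DictIdx p L) : AEStronglyMeasurable (φhat v) μ := by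
  match v with
  | Sum.inl (i, l) => rw [h.first_order]; exact aestronglyMeasurable_phiOne hΨ i l
  | Sum.inr (ij, l, m) =>
    obtain ⟨lam, -, e⟩ := h.second_order ij l m
    rw [e]; exact aestronglyMeasurable_interFun hΨ _ _ _ _ _ _

/-- Points at which every first order function is bounded by `M`. -/
def FirstOrderBdd (Ψ : Fin p → Fin (L + 1) → ℝ → ℝ) (M : ℝ) (x : Fin p → ℝ) : Prop :=
  ∀ i (l : Fin L), |phiOne Ψ i l x| ≤ M

theorem FirstOrderBdd.pairVec_le {M : ℝ} {x : Fin p → ℝ} (h : FirstOrderBdd Ψ M x) (i j : Fin p)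
    (a : Fin L ⊕ Fin L) : |pairVec Ψ i j a x| ≤ M := by
  rw [pairVec_eq_phiOne]; exact h _ _

theorem FirstOrderBdd.sum_pairVec_le {M c : ℝ} {x : Fin p → ℝ} (h : FirstOrderBdd Ψ M x)
    (i j : Fin p) {lam : Fin L ⊕ Fin L → ℝ} (hlam : ‖lam‖ ≤ c) :
    |∑ a, lam a * pairVec Ψ i j a x| ≤ 2 * L * c * M := by
  calc |∑ a, lam a * pairVec Ψ i j a x| ≤ ∑ a, |lam a * pairVec Ψ i j a x| :=
        Finset.abs_sum_le_sum_abs _ _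
    _ ≤ ∑ _a : Fin L ⊕ Fin L, c * M := Finset.sum_le_sum fun a _ => by
        rw [abs_mul]
        exact mul_le_mul ((norm_le_pi_norm lam a).trans hlam) (h.pairVec_le i j a) (abs_nonneg _)
          ((norm_nonneg _).trans hlam)
    _ = _ := by simp [nsmul_eq_mul]; ring

theorem FirstOrderBdd.interUncentered_le {M c : ℝ} {x : Fin p → ℝ} (h : FirstOrderBdd Ψ M x)
    (i j : Fin p) (l m : Fin L) {lam : Fin L ⊕ Fin L → ℝ} (hlam : ‖lam‖ ≤ c) :
    |interUncentered Ψ i j l m lam x| ≤ M ^ 2 + 2 * L * c * M := by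
  refine (abs_add_le _ _).trans (add_le_add ?_ (h.sum_pairVec_le i j hlam))
  rw [abs_mul, sq]
  exact mul_le_mul (h i l) (h j m) (abs_nonneg _) ((abs_nonneg _).trans (h i l))

variable {M : ℝ}

theorem ae_firstOrderBdd (hM : ∀ i (l : Fin L), ∀ᵐ x ∂μ, |phiOne Ψ i l x| ≤ M) :
    ∀ᵐ x ∂μ, FirstOrderBdd Ψ M x :=
  ae_all_iff.2 fun i => ae_all_iff.2 fun l => hM i l

theorem abs_integral_le_of_ae_le [IsProbabilityMeasure μ] {f : (Fin p → ℝ) → ℝ} {b : ℝ}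
    (h : ∀ᵐ x ∂μ, |f x| ≤ b) : |∫ x, f x ∂μ| ≤ b := by
  have := norm_integral_le_of_norm_le_const (μ := μ) (f := f) (C := b) (by simpa using h)
  simpa using this

theorem abs_gramA_expect_le [IsProbabilityMeasure μ] (hbdd : ∀ᵐ x ∂μ, FirstOrderBdd Ψ M x)
    (i j : Fin p) (a b : Fin L ⊕ Fin L) : |gramA (expect μ) Ψ i j a b| ≤ M ^ 2 := by
  refine abs_integral_le_of_ae_le ?_
  filter_upwards [hbdd] with x hx
  rw [abs_mul, sq]
  exact mul_le_mul (hx.pairVec_le i j a) (hx.pairVec_le i j b) (abs_nonneg _)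
    ((abs_nonneg _).trans (hx.pairVec_le i j a))

theorem integrable_mul_of_firstOrderBdd [IsProbabilityMeasure μ]
    (hbdd : ∀ᵐ x ∂μ, FirstOrderBdd Ψ M x) {f g : (Fin p → ℝ) → ℝ} {a b : ℝ}
    (hf : AEStronglyMeasurable f μ) (hg : AEStronglyMeasurable g μ)
    (hfa : ∀ x, FirstOrderBdd Ψ M x → |f x| ≤ a) (hgb : ∀ x, FirstOrderBdd Ψ M x → |g x| ≤ b) :
    Integrable (fun x => f x * g x) μ := by
  refine Integrable.of_bound (hf.mul hg) (a * b) ?_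
  filter_upwards [hbdd] with x hx
  rw [Real.norm_eq_abs, abs_mul]
  exact mul_le_mul (hfa x hx) (hgb x hx) (abs_nonneg _) ((abs_nonneg _).trans (hfa x hx))

theorem integrable_of_firstOrderBdd [IsProbabilityMeasure μ]
    (hbdd : ∀ᵐ x ∂μ, FirstOrderBdd Ψ M x) {f : (Fin p → ℝ) → ℝ} {a : ℝ}
    (hf : AEStronglyMeasurable f μ) (hfa : ∀ x, FirstOrderBdd Ψ M x → |f x| ≤ a) :
    Integrable f μ := by
  refine Integrable.of_bound hf a ?_
  filter_upwards [hbdd] with x hx using hfa x hx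

/-- The coefficients of the theoretical second order function `φ^{ij}_{(l,m)}`. -/
noncomputable def interCoeff (μ : Measure (Fin p → ℝ)) (Ψ : Fin p → Fin (L + 1) → ℝ → ℝ) (i j : Fin p)
    (l m : Fin L) : Fin L ⊕ Fin L → ℝ :=
  (gramA (expect μ) Ψ i j)⁻¹.mulVec (rhsD (expect μ) Ψ i j l m)

theorem hofdBasis_inr (ij : {ij : Fin p × Fin p // ij.1 < ij.2}) (l m : Fin L)
    (x : Fin p → ℝ) : hofdBasis μ Ψ (Sum.inr (ij, l, m)) x =
      interUncentered Ψ ij.1.1 ij.1.2 l m (interCoeff μ Ψ ij.1.1 ij.1.2 l m) x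
        - ∫ x, interUncentered Ψ ij.1.1 ij.1.2 l m (interCoeff μ Ψ ij.1.1 ij.1.2 l m) x ∂μ := rfl

theorem gramA_mulVec_interCoeff {i j : Fin p} (hdet : (gramA (expect μ) Ψ i j).det ≠ 0)
    (l m : Fin L) : (gramA (expect μ) Ψ i j).mulVec (interCoeff μ Ψ i j l m)
      = rhsD (expect μ) Ψ i j l m := by
  rw [interCoeff, Matrix.mulVec_mulVec, Matrix.mul_nonsing_inv _ (isUnit_iff_ne_zero.2 hdet),
    Matrix.one_mulVec]

/-- The Gram matrices of pairs are invertible, with inverse bounded by `Λ`. -/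
structure GramBdd (μ : Measure (Fin p → ℝ)) (Ψ : Fin p → Fin (L + 1) → ℝ → ℝ) (M Λ : ℝ) :
    Prop where
  one_le : 1 ≤ M
  nonneg : 0 ≤ Λ
  orthonormal : ∀ i, IsOrthonormalSystem (μ.map fun x => x i) (Ψ i)
  bdd : ∀ᵐ x ∂μ, FirstOrderBdd Ψ M x
  det_ne_zero : ∀ i j : Fin p, i ≠ j → (gramA (expect μ) Ψ i j).det ≠ 0
  norm_le : ∀ i j : Fin p, i ≠ j → ∀ v : Fin L ⊕ Fin L → ℝ,
    ‖v‖ ≤ Λ * ‖(gramA (expect μ) Ψ i j).mulVec v‖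

variable {Λ : ℝ}

/-- A bound for all functions of the theoretical dictionary. -/
noncomputable def dictBound (L : ℕ) (M Λ : ℝ) : ℝ := 2 * (M ^ 2 + 2 * L * (Λ * M ^ 3) * M)

theorem GramBdd.le_dictBound (h : GramBdd μ Ψ M Λ) : M ≤ dictBound L M Λ := by
  have h1 := h.one_le
  have h2 : 0 ≤ 2 * L * (Λ * M ^ 3) * M := by
    have := h.nonneg; positivity
  unfold dictBound; nlinarith

theorem GramBdd.integral_pairVec (h : GramBdd μ Ψ M Λ) (i j : Fin p) (a : Fin L ⊕ Fin L) :
    ∫ x, pairVec Ψ i j a x ∂μ = 0 := by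
  rw [pairVec_eq_phiOne]; exact integral_phiOne h.orthonormal _ _

variable [IsProbabilityMeasure μ]

theorem GramBdd.norm_interCoeff_le (h : GramBdd μ Ψ M Λ) {i j : Fin p} (hij : i ≠ j)
    (l m : Fin L) : ‖interCoeff μ Ψ i j l m‖ ≤ Λ * M ^ 3 := by
  have hM : 0 ≤ M := zero_le_one.trans h.one_le
  refine (h.norm_le i j hij _).trans ?_
  rw [gramA_mulVec_interCoeff (h.det_ne_zero i j hij)]
  refine mul_le_mul_of_nonneg_left ?_ h.nonneg
  rw [pi_norm_le_iff_of_nonneg (by positivity)]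
  intro a
  rw [Real.norm_eq_abs, rhsD, abs_neg]
  refine abs_integral_le_of_ae_le ?_
  filter_upwards [h.bdd] with x hx
  rw [abs_mul, abs_mul, pow_succ, sq]
  gcongr
  · exact hx i l
  · exact hx j m
  · exact hx.pairVec_le i j a

theorem GramBdd.abs_hofdBasis_le (h : GramBdd μ Ψ M Λ) (v : DictIdx p L) {x : Fin p → ℝ}
    (hx : FirstOrderBdd Ψ M x) : |hofdBasis μ Ψ v x| ≤ dictBound L M Λ := by
  match v with
  | Sum.inl (i, l) => exact (hx i l).trans h.le_dictBound
  | Sum.inr (ij, l, m) =>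
    have hc := h.norm_interCoeff_le ij.2.ne l m
    rw [hofdBasis_inr, dictBound, two_mul]
    refine (abs_sub _ _).trans (add_le_add (hx.interUncentered_le _ _ l m hc) ?_)
    refine abs_integral_le_of_ae_le ?_
    filter_upwards [h.bdd] with y hy using hy.interUncentered_le _ _ l m hc

theorem GramBdd.integrable_hofdBasis (h : GramBdd μ Ψ M Λ) (v : DictIdx p L) :
    Integrable (hofdBasis μ Ψ v) μ :=
  integrable_of_firstOrderBdd h.bdd (aestronglyMeasurable_hofdBasis h.orthonormal v)
    fun _ hx => h.abs_hofdBasis_le v hx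

theorem GramBdd.integrable_interUncentered (h : GramBdd μ Ψ M Λ) (i j : Fin p) (l m : Fin L)
    (lam : Fin L ⊕ Fin L → ℝ) : Integrable (interUncentered Ψ i j l m lam) μ :=
  integrable_of_firstOrderBdd h.bdd
    (aestronglyMeasurable_interUncentered h.orthonormal i j l m lam)
    fun _ hx => hx.interUncentered_le i j l m le_rfl

theorem GramBdd.integral_hofdBasis (h : GramBdd μ Ψ M Λ) (v : DictIdx p L) :
    ∫ x, hofdBasis μ Ψ v x ∂μ = 0 := by
  match v with
  | Sum.inl (i, l) => exact integral_phiOne h.orthonormal i l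
  | Sum.inr (ij, l, m) =>
    simp only [hofdBasis_inr]
    rw [integral_sub (h.integrable_interUncentered _ _ _ _ _) (integrable_const _)]
    simp

theorem GramBdd.integrable_phiOne_mul (h : GramBdd μ Ψ M Λ) (i j : Fin p) (l m : Fin L) :
    Integrable (fun x => phiOne Ψ i l x * phiOne Ψ j m x) μ :=
  integrable_mul_of_firstOrderBdd h.bdd (aestronglyMeasurable_phiOne h.orthonormal _ _)
    (aestronglyMeasurable_phiOne h.orthonormal _ _) (fun _ hx => hx i l) (fun _ hx => hx j m)

theorem GramBdd.integrable_pairVec (h : GramBdd μ Ψ M Λ) (i j : Fin p) (a : Fin L ⊕ Fin L) :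
    Integrable (pairVec Ψ i j a) μ :=
  integrable_of_firstOrderBdd h.bdd (aestronglyMeasurable_pairVec h.orthonormal _ _ _)
    fun _ hx => hx.pairVec_le i j a

theorem GramBdd.integrable_pairVec_mul (h : GramBdd μ Ψ M Λ) (i j : Fin p)
    (a b : Fin L ⊕ Fin L) : Integrable (fun x => pairVec Ψ i j a x * pairVec Ψ i j b x) μ :=
  integrable_mul_of_firstOrderBdd h.bdd (aestronglyMeasurable_pairVec h.orthonormal _ _ _)
    (aestronglyMeasurable_pairVec h.orthonormal _ _ _) (fun _ hx => hx.pairVec_le i j a)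
    (fun _ hx => hx.pairVec_le i j b)

/-- Main effects are centered, so the mean is that of the product alone. The bound therefore does
not involve `lam`, whose size may grow with `Λ`. -/
theorem GramBdd.abs_integral_interUncentered_le (h : GramBdd μ Ψ M Λ) (i j : Fin p)
    (l m : Fin L) (lam : Fin L ⊕ Fin L → ℝ) :
    |∫ x, interUncentered Ψ i j l m lam x ∂μ| ≤ M ^ 2 := by
  have e : ∫ x, interUncentered Ψ i j l m lam x ∂μ = ∫ x, phiOne Ψ i l x * phiOne Ψ j m x ∂μ := by
    unfold interUncentered
    rw [integral_add (h.integrable_phiOne_mul i j l m)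
      (integrable_finsetSum _ fun a _ => (h.integrable_pairVec i j a).const_mul _),
      integral_finsetSum _ fun a _ => (h.integrable_pairVec i j a).const_mul _]
    simp [integral_const_mul, h.integral_pairVec]
  rw [e]
  refine abs_integral_le_of_ae_le ?_
  filter_upwards [h.bdd] with x hx
  rw [abs_mul, sq]
  exact mul_le_mul (hx i l) (hx j m) (abs_nonneg _) ((abs_nonneg _).trans (hx i l))

/-- A theoretical second order function is orthogonal to its first order functions. -/
theorem GramBdd.integral_hofdBasis_mul_pairVec (h : GramBdd μ Ψ M Λ)
    (ij : {ij : Fin p × Fin p // ij.1 < ij.2}) (l m : Fin L) (a : Fin L ⊕ Fin L) :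
    ∫ x, hofdBasis μ Ψ (Sum.inr (ij, l, m)) x * pairVec Ψ ij.1.1 ij.1.2 a x ∂μ = 0 := by
  obtain ⟨⟨i, j⟩, hij⟩ := ij
  have hA := congrFun (gramA_mulVec_interCoeff (h.det_ne_zero i j (ne_of_lt hij)) l m) a
  have hI : Integrable (fun x => phiOne Ψ i l x * phiOne Ψ j m x * pairVec Ψ i j a x) μ := by
    refine integrable_mul_of_firstOrderBdd (a := M * M) h.bdd
      (h.integrable_phiOne_mul i j l m).aestronglyMeasurable
      (aestronglyMeasurable_pairVec h.orthonormal i j a) (fun x hx => ?_)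
      (fun _ hx => hx.pairVec_le i j a)
    rw [abs_mul]
    exact mul_le_mul (hx i l) (hx j m) (abs_nonneg _) ((abs_nonneg _).trans (hx i l))
  have hS : ∀ b, Integrable (fun x => interCoeff μ Ψ i j l m b
      * (pairVec Ψ i j a x * pairVec Ψ i j b x)) μ :=
    fun b => (h.integrable_pairVec_mul i j a b).const_mul _
  set c := ∫ x, interUncentered Ψ i j l m (interCoeff μ Ψ i j l m) x ∂μ with hc
  have e : ∀ x, hofdBasis μ Ψ (Sum.inr (⟨(i, j), hij⟩, l, m)) x * pairVec Ψ i j a x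
      = phiOne Ψ i l x * phiOne Ψ j m x * pairVec Ψ i j a x
        + ∑ b, interCoeff μ Ψ i j l m b * (pairVec Ψ i j a x * pairVec Ψ i j b x)
        - c * pairVec Ψ i j a x := by
    intro x
    rw [hofdBasis_inr, ← hc, interUncentered, sub_mul, add_mul, Finset.sum_mul]
    congr 2
    exact Finset.sum_congr rfl fun b _ => by ring
  have hI2 : Integrable (fun x => phiOne Ψ i l x * phiOne Ψ j m x * pairVec Ψ i j a x
        + ∑ b, interCoeff μ Ψ i j l m b * (pairVec Ψ i j a x * pairVec Ψ i j b x)) μ :=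
    hI.add (integrable_finsetSum _ fun b _ => hS b)
  simp only [e]
  rw [integral_sub hI2 ((h.integrable_pairVec i j a).const_mul _),
    integral_add hI (integrable_finsetSum _ fun b _ => hS b),
    integral_finsetSum _ fun b _ => hS b]
  simp only [integral_const_mul, h.integral_pairVec, mul_zero, sub_zero]
  simp only [Matrix.mulVec, dotProduct, gramA, rhsD, expect, Matrix.of_apply] at hA
  simp only [mul_comm (interCoeff μ Ψ i j l m _)]
  rw [hA]; ring

/-- Deviations of order `t` of the empirical means of the theoretical dictionary over the sample
used for the estimation of the dictionary. -/
structure DictDev (μ : Measure (Fin p → ℝ)) (Ψ : Fin p → Fin (L + 1) → ℝ → ℝ) (M t : ℝ)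
    (I : Finset ℕ) (x : ℕ → Fin p → ℝ) : Prop where
  bdd : ∀ r ∈ I, FirstOrderBdd Ψ M (x r)
  mean : ∀ v, |sampleMean I (fun r => hofdBasis μ Ψ v (x r)) - ∫ y, hofdBasis μ Ψ v y ∂μ| ≤ t
  mul : ∀ (v : DictIdx p L) i l,
    |sampleMean I (fun r => hofdBasis μ Ψ v (x r) * phiOne Ψ i l (x r))
      - ∫ y, hofdBasis μ Ψ v y * phiOne Ψ i l y ∂μ| ≤ t

/-- The estimated dictionary is close to the theoretical one. -/
theorem GramBdd.abs_sub_hofdBasis_le (h : GramBdd μ Ψ M Λ) {I : Finset ℕ} (hI : 0 < I.card)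
    {x : ℕ → Fin p → ℝ} {t : ℝ} (ht : 0 ≤ t) (hsmall : Λ * ((L + L : ℕ) * t) ≤ 1 / 2)
    (hd : DictDev μ Ψ M t I x) {φhat : DictIdx p L → (Fin p → ℝ) → ℝ}
    (hφ : IsEHOFD I x Ψ φhat) (v : DictIdx p L) {y : Fin p → ℝ} (hy : FirstOrderBdd Ψ M y) :
    |φhat v y - hofdBasis μ Ψ v y|
      ≤ 2 * (2 * L * (2 * Λ * (t + M ^ 2 * t)) * M) + t := by
  have hM : 0 ≤ M := zero_le_one.trans h.one_le
  have hΛ := h.nonneg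
  match v with
  | Sum.inl (i, l) =>
    rw [hφ.first_order]
    change |phiOne Ψ i l y - phiOne Ψ i l y| ≤ _
    rw [sub_self, abs_zero]; positivity
  | Sum.inr (⟨(i, j), hij⟩, l, m) =>
    obtain ⟨lam', hlam', e'⟩ := hφ.second_order ⟨(i, j), hij⟩ l m
    dsimp only at hlam' e'
    have hne : i ≠ j := ne_of_lt hij
    set lam := interCoeff μ Ψ i j l m with hlam
    set c := ∫ x, interUncentered Ψ i j l m lam x ∂μ with hc
    set v : DictIdx p L := Sum.inr (⟨(i, j), hij⟩, l, m) with hv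
    have hφv : ∀ z, hofdBasis μ Ψ v z = interUncentered Ψ i j l m lam z - c := fun z => rfl
    have hmean : |sampleMean I fun r => hofdBasis μ Ψ v (x r)| ≤ t := by
      have := hd.mean v
      rwa [h.integral_hofdBasis, sub_zero] at this
    have hmeanP : ∀ a, |sampleMean I fun r => pairVec Ψ i j a (x r)| ≤ t := fun a => by
      have := hd.mean (Sum.inl (Sum.elim (fun _ => i) (fun _ => j) a, Sum.elim id id a))
      rw [h.integral_hofdBasis, sub_zero] at this
      rw [pairVec_eq_phiOne]; exact this
    have hmul : ∀ a, |sampleMean I fun r => hofdBasis μ Ψ v (x r) * pairVec Ψ i j a (x r)| ≤ t :=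
      fun a => by
        have h1 := hd.mul v (Sum.elim (fun _ => i) (fun _ => j) a) (Sum.elim id id a)
        have h2 := h.integral_hofdBasis_mul_pairVec ⟨(i, j), hij⟩ l m a
        dsimp only at h2
        rw [← pairVec_eq_phiOne, h2, sub_zero] at h1
        exact h1
    have hgram : ∀ a b, |gramA (empMean I x) Ψ i j a b - gramA (expect μ) Ψ i j a b| ≤ t :=
      fun a b => by
        have := hd.mul (Sum.inl (Sum.elim (fun _ => i) (fun _ => j) a, Sum.elim id id a))
          (Sum.elim (fun _ => i) (fun _ => j) b) (Sum.elim id id b)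
        simp only [gramA, Matrix.of_apply, empMean, expect, pairVec_eq_phiOne]
        exact this
    -- The empirical Gram matrix inherits a lower bound, so whichever solution of the empirical
    -- system is chosen must be close to `lam`.
    have hinv := norm_le_mul_norm_mulVec_of_perturbation hΛ (h.norm_le i j hne) hgram ht
      (by simpa using hsmall) (lam' - lam)
    have hres : ‖(gramA (empMean I x) Ψ i j).mulVec (lam' - lam)‖ ≤ t + M ^ 2 * t := by
      rw [pi_norm_le_iff_of_nonneg (by positivity)]
      intro a
      -- The residual of `lam` in the empirical system is an empirical inner product of `φ^{ij}`,
      -- with its constant restored, against a main effect. Its theoretical value is zero, so it is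
      -- of order `t` without any factor `‖lam‖`; comparing the two systems term by term would lose
      -- a second power of `Λ`.
      have e : (gramA (empMean I x) Ψ i j).mulVec (lam' - lam) a =
          -(sampleMean I (fun r => hofdBasis μ Ψ v (x r) * pairVec Ψ i j a (x r))
            + c * sampleMean I fun r => pairVec Ψ i j a (x r)) := by
        rw [Matrix.mulVec_sub, hlam', Pi.sub_apply, ← sampleMean_const_mul, ← sampleMean_add]
        simp only [rhsD, Matrix.mulVec, dotProduct, gramA, Matrix.of_apply, empMean]
        have e1 : ∀ b, sampleMean I (fun r => pairVec Ψ i j a (x r) * pairVec Ψ i j b (x r))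
            * lam b = sampleMean I (fun r =>
              lam b * (pairVec Ψ i j a (x r) * pairVec Ψ i j b (x r))) := fun b => by
          rw [sampleMean_const_mul, mul_comm]
        simp only [e1]
        rw [← sampleMean_sum, ← neg_add', ← sampleMean_add]
        congr 2
        funext r
        rw [hφv, interUncentered, sub_mul, add_mul, Finset.sum_mul, sub_add_cancel]
        congr 1
        exact Finset.sum_congr rfl fun b _ => by ring
      rw [e, norm_neg, Real.norm_eq_abs]
      refine (abs_add_le _ _).trans (add_le_add (hmul a) ?_)
      rw [abs_mul]
      gcongr
      · exact h.abs_integral_interUncentered_le i j l m lam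
      · exact hmeanP a
    have hdel : ‖lam' - lam‖ ≤ 2 * Λ * (t + M ^ 2 * t) := hinv.trans (by gcongr)
    have hdec : ∀ z, interUncentered Ψ i j l m lam' z = hofdBasis μ Ψ v z + c
        + ∑ a, (lam' - lam) a * pairVec Ψ i j a z := fun z => by
      rw [hφv, sub_add_cancel, interUncentered, interUncentered, add_assoc,
        ← Finset.sum_add_distrib]
      congr 1
      exact Finset.sum_congr rfl fun b _ => by rw [Pi.sub_apply]; ring
    -- The constant `c` cancels between the function and its empirical mean. What remains is the
    -- coefficient error, empirically centered, and the empirical mean of `φ^{ij}`.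
    have e2 : φhat v y - hofdBasis μ Ψ v y = (∑ a, (lam' - lam) a * pairVec Ψ i j a y
        - sampleMean I fun r => ∑ a, (lam' - lam) a * pairVec Ψ i j a (x r))
        - sampleMean I fun r => hofdBasis μ Ψ v (x r) := by
      rw [e', interFun, empMean]
      simp only [hdec]
      rw [sampleMean_add, sampleMean_add, sampleMean_const hI]
      ring
    rw [e2, two_mul (2 * (L : ℝ) * _ * M)]
    refine (abs_sub _ _).trans (add_le_add ((abs_sub _ _).trans (add_le_add ?_ ?_)) hmean)
    · exact hy.sum_pairVec_le i j hdel
    · exact abs_sampleMean_le_of_le hI fun r hr => (hd.bdd r hr).sum_pairVec_le i j hdel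

end Dictionary

/-! ### From functions to the Hilbert space `L²`. -/

theorem sum_smul_toLp {α ι : Type*} [MeasurableSpace α] {μ : Measure α} (s : Finset ι) (c : ι → ℝ)
    {f : ι → α → ℝ} (hf : ∀ i, MemLp (f i) 2 μ) :
    ∑ i ∈ s, c i • (hf i).toLp (f i) =
      (memLp_finsetSum s fun i _ => (hf i).const_mul (c i)).toLp
        (fun x => ∑ i ∈ s, c i * f i x) := by
  classical
  induction s using Finset.induction_on with
  | empty => simp only [Finset.sum_empty]; exact (MemLp.toLp_zero _).symm
  | insert a s ha ih =>
    rw [Finset.sum_insert ha, ih, ← MemLp.toLp_const_smul, ← MemLp.toLp_add]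
    refine MemLp.toLp_congr _ _ (Eventually.of_forall fun x => ?_)
    simp [Finset.sum_insert ha]

theorem inner_toLp_toLp {α : Type*} [MeasurableSpace α] {μ : Measure α} {f g : α → ℝ}
    (hf : MemLp f 2 μ) (hg : MemLp g 2 μ) :
    inner ℝ (hf.toLp f) (hg.toLp g) = ∫ x, f x * g x ∂μ := by
  rw [L2.inner_def]
  refine integral_congr_ae ?_
  filter_upwards [hf.coeFn_toLp, hg.coeFn_toLp] with x hx hy
  rw [hx, hy]
  simp [mul_comm]

theorem norm_toLp_sq {α : Type*} [MeasurableSpace α] {μ : Measure α} {f : α → ℝ}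
    (hf : MemLp f 2 μ) : ‖hf.toLp f‖ ^ 2 = ∫ x, f x ^ 2 ∂μ := by
  rw [← real_inner_self_eq_norm_sq, inner_toLp_toLp]
  simp only [sq]

/-! ### Boosting with the estimated dictionary, on the deviation events. -/

section Perturbation

/-- The error is weighted by squares because the second moments of the dictionary are bounded by a
fixed `B`, whereas its sup norm is only known to be bounded by a multiple of `n ^ ϑ`. -/
theorem abs_mul_sub_mul_le_left {a b b' ζ : ℝ} (hb : |b' - b| ≤ ζ) :
    |a * b' - a * b| ≤ ζ * (3 + a ^ 2 + b ^ 2) := by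
  have h0 : 0 ≤ ζ := (abs_nonneg _).trans hb
  rw [← mul_sub, abs_mul, mul_comm]
  have : |a| ≤ 3 + a ^ 2 + b ^ 2 := by nlinarith [sq_abs a, sq_nonneg (|a| - 1), sq_nonneg b]
  gcongr

theorem abs_mul_sub_mul_le {a a' b b' ζ : ℝ} (ha : |a' - a| ≤ ζ) (hb : |b' - b| ≤ ζ)
    (hζ : ζ ≤ 1) : |a' * b' - a * b| ≤ ζ * (3 + a ^ 2 + b ^ 2) := by
  have h0 : 0 ≤ ζ := (abs_nonneg _).trans hb
  have e : a' * b' - a * b = (a' - a) * (b + (b' - b)) + a * (b' - b) := by ring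
  have h1 : |b + (b' - b)| ≤ |b| + 1 := (abs_add_le _ _).trans (by linarith)
  have h2 : |b| + 1 + |a| ≤ 3 + a ^ 2 + b ^ 2 := by
    nlinarith [sq_abs a, sq_abs b, sq_nonneg (|a| - 1), sq_nonneg (|b| - 1)]
  calc |a' * b' - a * b| ≤ |a' - a| * |b + (b' - b)| + |a| * |b' - b| := by
        rw [e, ← abs_mul, ← abs_mul]; exact abs_add_le _ _
    _ ≤ ζ * (|b| + 1) + |a| * ζ := by gcongr
    _ = ζ * (|b| + 1 + |a|) := by ring
    _ ≤ _ := by gcongr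

end Perturbation

/-- Deviations of order `t` over the sample used for boosting, with noise `e`. -/
structure BoostDev {p L : ℕ} (μ : Measure (Fin p → ℝ)) (Ψ : Fin p → Fin (L + 1) → ℝ → ℝ)
    (M t T : ℝ) (I : Finset ℕ) (x : ℕ → Fin p → ℝ) (e : ℕ → ℝ) : Prop where
  bdd : ∀ r ∈ I, FirstOrderBdd Ψ M (x r)
  mul : ∀ v w : DictIdx p L,
    |sampleMean I (fun r => hofdBasis μ Ψ v (x r) * hofdBasis μ Ψ w (x r))
      - ∫ y, hofdBasis μ Ψ v y * hofdBasis μ Ψ w y ∂μ| ≤ t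
  noise : ∀ v : DictIdx p L, |sampleMean I (fun r => e r * hofdBasis μ Ψ v (x r))| ≤ t
  abs_noise : sampleMean I (fun r => |e r|) ≤ T

section Cross

variable {p L : ℕ} {μ : Measure (Fin p → ℝ)} [IsProbabilityMeasure μ]
  {Ψ : Fin p → Fin (L + 1) → ℝ → ℝ} {M Λ t T B ζ : ℝ} {I : Finset ℕ} {x : ℕ → Fin p → ℝ}
  {e : ℕ → ℝ}

/-- Transfer of deviations from products of dictionary functions to nearby functions. -/
theorem BoostDev.abs_sampleMean_sub_integral_le (hd : BoostDev μ Ψ M t T I x e)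
    (h : GramBdd μ Ψ M Λ) (hI : 0 < I.card) (ht1 : t ≤ 1)
    (hB : ∀ v, ∫ y, hofdBasis μ Ψ v y ^ 2 ∂μ ≤ B) (hζ : 0 ≤ ζ) (v w : DictIdx p L)
    {f : (Fin p → ℝ) → ℝ} (hf : Integrable f μ)
    (hfζ : ∀ y, FirstOrderBdd Ψ M y → |f y - hofdBasis μ Ψ v y * hofdBasis μ Ψ w y|
      ≤ ζ * (3 + hofdBasis μ Ψ v y ^ 2 + hofdBasis μ Ψ w y ^ 2)) :
    |∫ y, f y ∂μ - ∫ y, hofdBasis μ Ψ v y * hofdBasis μ Ψ w y ∂μ| ≤ ζ * (3 + 2 * B) ∧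
    |sampleMean I (fun r => f (x r)) - ∫ y, f y ∂μ| ≤ t + ζ * (8 + 4 * B) := by
  have hint : ∀ v w, Integrable (fun y => hofdBasis μ Ψ v y * hofdBasis μ Ψ w y) μ := fun v w =>
    integrable_mul_of_firstOrderBdd h.bdd (h.integrable_hofdBasis v).1
      (h.integrable_hofdBasis w).1 (fun _ hx => h.abs_hofdBasis_le v hx)
      (fun _ hx => h.abs_hofdBasis_le w hx)
  have hint2 : ∀ v, Integrable (fun y => hofdBasis μ Ψ v y ^ 2) μ := fun v => by
    simpa only [sq] using hint v v
  have h1 : |∫ y, f y ∂μ - ∫ y, hofdBasis μ Ψ v y * hofdBasis μ Ψ w y ∂μ| ≤ ζ * (3 + 2 * B) := by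
    rw [← integral_sub hf (hint v w)]
    have h3 : Integrable (fun y => 3 + hofdBasis μ Ψ v y ^ 2) μ :=
      (integrable_const _).add (hint2 v)
    have hR : Integrable (fun y => ζ * (3 + hofdBasis μ Ψ v y ^ 2 + hofdBasis μ Ψ w y ^ 2)) μ :=
      (h3.add (hint2 w)).const_mul ζ
    refine (abs_integral_le_integral_abs).trans ((integral_mono_ae (hf.sub (hint v w)).abs hR
      (h.bdd.mono fun y hy => hfζ y hy)).trans ?_)
    rw [integral_const_mul, integral_add h3 (hint2 w), integral_add (integrable_const _) (hint2 v)]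
    simp only [integral_const, probReal_univ, one_smul]
    exact mul_le_mul_of_nonneg_left (by linarith [hB v, hB w]) hζ
  refine ⟨h1, ?_⟩
  -- Empirical second moments exceed theoretical ones by at most `t ≤ 1`. This turns `3 + 2 * B`
  -- into `5 + 2 * B`, and the two add up to `8 + 4 * B`.
  have hsq : ∀ v, sampleMean I (fun r => hofdBasis μ Ψ v (x r) ^ 2) ≤ B + 1 := fun v => by
    have h2 := le_of_abs_le (hd.mul v v)
    have h3 := hB v
    simp only [← sq] at h2
    linarith
  have h2 : |sampleMean I (fun r => f (x r))
      - sampleMean I (fun r => hofdBasis μ Ψ v (x r) * hofdBasis μ Ψ w (x r))|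
      ≤ ζ * (5 + 2 * B) := by
    rw [← sampleMean_sub]
    refine (abs_sampleMean_le _).trans ((sampleMean_mono fun r hr => hfζ _ (hd.bdd r hr)).trans ?_)
    rw [sampleMean_const_mul, sampleMean_add, sampleMean_add, sampleMean_const hI]
    exact mul_le_mul_of_nonneg_left (by linarith [hsq v, hsq w]) hζ
  have h3 := hd.mul v w
  have e1 : sampleMean I (fun r => f (x r)) - ∫ y, f y ∂μ =
      (sampleMean I (fun r => f (x r))
        - sampleMean I (fun r => hofdBasis μ Ψ v (x r) * hofdBasis μ Ψ w (x r)))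
      + (sampleMean I (fun r => hofdBasis μ Ψ v (x r) * hofdBasis μ Ψ w (x r))
        - ∫ y, hofdBasis μ Ψ v y * hofdBasis μ Ψ w y ∂μ)
      - (∫ y, f y ∂μ - ∫ y, hofdBasis μ Ψ v y * hofdBasis μ Ψ w y ∂μ) := by ring
  rw [e1]
  refine (abs_sub _ _).trans ((add_le_add ((abs_add_le _ _).trans (add_le_add h2 h3)) h1).trans ?_)
  linarith

end Cross

/-- Boosting with an estimated dictionary that is close to the theoretical one approximates the
signal, as soon as the empirical inner products are close to the theoretical ones. -/
theorem eLpNorm_boosting_sub_signal_le {γ B B' K δ : ℝ} (hγ : 0 < γ) (hγB : γ * B' < 2)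
    (hK : 0 ≤ K) (hB0 : 0 ≤ B) (hδ : 0 < δ) :
    ∃ N : ℕ, ∃ η : ℝ, 0 < η ∧ ∀ (p L : ℕ) (μ : Measure (Fin p → ℝ)) [IsProbabilityMeasure μ]
      (Ψ : Fin p → Fin (L + 1) → ℝ → ℝ) (M Λ t T ζ : ℝ) (I : Finset ℕ) (x : ℕ → Fin p → ℝ)
      (e : ℕ → ℝ) (β : DictIdx p L → ℝ) (φhat : DictIdx p L → (Fin p → ℝ) → ℝ)
      (G : ℕ → (Fin p → ℝ) → ℝ) (k : ℕ), GramBdd μ Ψ M Λ → 0 < I.card →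
      (∀ v, ∫ y, hofdBasis μ Ψ v y ^ 2 ∂μ ≤ B) → ∑ v, |β v| ≤ K →
      BoostDev μ Ψ M t T I x e → (∀ v, AEStronglyMeasurable (φhat v) μ) →
      (∀ v y, FirstOrderBdd Ψ M y → |φhat v y - hofdBasis μ Ψ v y| ≤ ζ) →
      IsL2Boosting γ I x (fun s => signal μ Ψ β (x s) + e s) φhat G →
      0 ≤ ζ → ζ ≤ 1 → 0 ≤ t → t ≤ 1 → 0 ≤ T → B + ζ * (3 + 2 * B) ≤ B' → N ≤ k →
      (t + ζ * (8 + 4 * B + T)) * (1 + k) ≤ η →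
      eLpNorm (fun y => G k y - signal μ Ψ β y) 2 μ ≤ ENNReal.ofReal δ := by
  obtain ⟨N, η, hη, H⟩ := inexact_boosting_norm_sq_le hγ hγB hK (pow_pos hδ 2)
  refine ⟨N, η, hη, ?_⟩
  intro p L μ _ Ψ M Λ t T ζ I x e β φhat G k h hI hB hβ hd hφm hφ hG hζ hζ1 ht ht1 hT hB' hNk hk
  have hφb : ∀ v y, FirstOrderBdd Ψ M y → |φhat v y| ≤ dictBound L M Λ + 1 := fun v y hy => by
    have h1 := hφ v y hy
    have h2 := h.abs_hofdBasis_le v hy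
    have h3 := abs_add_le (φhat v y - hofdBasis μ Ψ v y) (hofdBasis μ Ψ v y)
    rw [sub_add_cancel] at h3
    linarith
  have hΦL : ∀ v, MemLp (hofdBasis μ Ψ v) 2 μ := fun v =>
    MemLp.of_bound (h.integrable_hofdBasis v).1 (dictBound L M Λ)
      (h.bdd.mono fun y hy => h.abs_hofdBasis_le v hy)
  have hΨL : ∀ v, MemLp (φhat v) 2 μ := fun v =>
    MemLp.of_bound (hφm v) (dictBound L M Λ + 1) (h.bdd.mono fun y hy => hφb v y hy)
  choose v hmax hstep using hG.step
  set y : ℕ → ℝ := fun s => signal μ Ψ β (x s) + e s with hy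
  set E : ℕ → DictIdx p L → ℝ := fun j w => residInner I x y (G j) (φhat w) with hE
  have hGsum : ∀ j z, G j z = ∑ i ∈ Finset.range j, (γ * E i (v i)) * φhat (v i) z := by
    intro j z
    induction j with
    | zero => simpa using hG.init z
    | succ j ih => rw [hstep, ih, Finset.sum_range_succ]
  have hcross : ∀ u w, |sampleMean I (fun r => hofdBasis μ Ψ u (x r) * φhat w (x r))
      - ∫ z, hofdBasis μ Ψ u z * φhat w z ∂μ| ≤ t + ζ * (8 + 4 * B) := fun u w =>
    (hd.abs_sampleMean_sub_integral_le h hI ht1 hB hζ u w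
      (f := fun z => hofdBasis μ Ψ u z * φhat w z) ((hΦL u).integrable_mul (hΨL w))
      fun z hz => abs_mul_sub_mul_le_left (hφ w z hz)).2
  have hcross2 : ∀ u w, |∫ z, φhat u z * φhat w z ∂μ
        - ∫ z, hofdBasis μ Ψ u z * hofdBasis μ Ψ w z ∂μ| ≤ ζ * (3 + 2 * B) ∧
      |sampleMean I (fun r => φhat u (x r) * φhat w (x r))
      - ∫ z, φhat u z * φhat w z ∂μ| ≤ t + ζ * (8 + 4 * B) := fun u w =>
    hd.abs_sampleMean_sub_integral_le h hI ht1 hB hζ u w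
      (f := fun z => φhat u z * φhat w z) ((hΨL u).integrable_mul (hΨL w))
      fun z hz => abs_mul_sub_mul_le (hφ u z hz) (hφ w z hz) hζ1
  have hnoise : ∀ w, |sampleMean I (fun r => e r * φhat w (x r))| ≤ t + ζ * T := fun w => by
    have e1 : sampleMean I (fun r => e r * φhat w (x r)) =
        sampleMean I (fun r => e r * hofdBasis μ Ψ w (x r))
        + sampleMean I (fun r => e r * (φhat w (x r) - hofdBasis μ Ψ w (x r))) := by
      rw [← sampleMean_add]; congr 1; funext r; ring
    rw [e1]
    refine (abs_add_le _ _).trans (add_le_add (hd.noise w) ((abs_sampleMean_le _).trans ?_))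
    refine (sampleMean_mono (b := fun r => ζ * |e r|) fun r hr => ?_).trans ?_
    · rw [abs_mul, mul_comm]
      gcongr
      exact hφ w _ (hd.bdd r hr)
    · rw [sampleMean_const_mul]; gcongr; exact hd.abs_noise
  -- The residual measured under the true law: signal in the theoretical dictionary minus the fit in
  -- the estimated one.
  set R : ℕ → Lp ℝ 2 μ := fun j => ∑ w, β w • (hΦL w).toLp _
    - ∑ i ∈ Finset.range j, (γ * E i (v i)) • (hΨL (v i)).toLp _ with hR
  have hζ' : 0 ≤ t + ζ * (8 + 4 * B + T) := by positivity
  have hfin := H (Lp ℝ 2 μ) (DictIdx p L) (fun w => (hΦL w).toLp _) (fun w => (hΨL w).toLp _) β E v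
    R (t + ζ * (8 + 4 * B + T)) k hNk hζ' hk hβ ?_ ?_ (by simp [hR]) ?_ hmax ?_
  · have hm₁ := memLp_finsetSum Finset.univ fun w _ => (hΦL w).const_mul (β w)
    have hm₂ := memLp_finsetSum (Finset.range k) fun i _ => (hΨL (v i)).const_mul (γ * E i (v i))
    have hm := hm₁.sub hm₂
    have hsig : R k = hm.toLp _ := by
      rw [MemLp.toLp_sub hm₁ hm₂, ← sum_smul_toLp, ← sum_smul_toLp]
    have hnorm : eLpNorm (fun z => G k z - signal μ Ψ β z) 2 μ = ENNReal.ofReal ‖R k‖ := by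
      rw [hsig, Lp.norm_toLp, ENNReal.ofReal_toReal hm.eLpNorm_ne_top, ← eLpNorm_neg]
      congr 1
      funext z
      simp [hGsum, signal]
    rw [hnorm]
    exact ENNReal.ofReal_le_ofReal ((pow_le_pow_iff_left₀ (norm_nonneg _) hδ.le two_ne_zero).1 hfin)
  · intro w
    -- Estimated functions may be longer than theoretical ones; `B'` leaves room for this while
    -- keeping `γ * B' < 2`.
    rw [norm_toLp_sq]
    have h1 := le_of_abs_le (hcross2 w w).1
    have h2 := hB w
    simp only [← sq] at h1
    linarith
  · intro w
    rw [← MemLp.toLp_sub, Lp.norm_toLp]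
    have h1 : eLpNorm (hofdBasis μ Ψ w - φhat w) 2 μ ≤ ENNReal.ofReal ζ := by
      refine (eLpNorm_le_of_ae_bound (C := ζ) (h.bdd.mono fun z hz => ?_)).trans (by simp)
      rw [Pi.sub_apply, Real.norm_eq_abs, abs_sub_comm]
      exact hφ w z hz
    refine (ENNReal.toReal_le_of_le_ofReal hζ h1).trans ?_
    nlinarith [mul_nonneg hζ hB0, mul_nonneg hζ hT]
  · intro j
    simp only [hR, Finset.sum_range_succ]
    abel
  · intro j w
    have hEj : E j w = ∑ u, β u * sampleMean I (fun r => hofdBasis μ Ψ u (x r) * φhat w (x r))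
        + sampleMean I (fun r => e r * φhat w (x r))
        - ∑ i ∈ Finset.range j, (γ * E i (v i))
          * sampleMean I (fun r => φhat (v i) (x r) * φhat w (x r)) := by
      simp only [← sampleMean_const_mul]
      rw [← sampleMean_sum, ← sampleMean_sum, ← sampleMean_add, ← sampleMean_sub]
      change sampleMean I (fun r => (y r - G j (x r)) * φhat w (x r)) = _
      congr 1
      funext r
      have hyr : y r = ∑ u, β u * hofdBasis μ Ψ u (x r) + e r := rfl
      rw [hGsum, hyr, sub_mul, add_mul, Finset.sum_mul, Finset.sum_mul]
      simp only [mul_assoc]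
    have hin : inner ℝ (R j) ((hΨL w).toLp _) = ∑ u, β u * (∫ z, hofdBasis μ Ψ u z * φhat w z ∂μ)
        - ∑ i ∈ Finset.range j, (γ * E i (v i)) * ∫ z, φhat (v i) z * φhat w z ∂μ := by
      simp only [hR]
      rw [inner_sub_left, sum_inner, sum_inner]
      simp only [real_inner_smul_left, inner_toLp_toLp]
    -- The error is a combination of deviations of single inner products. The signal contributes
    -- `K`, the noise `1` and the past steps `γ ∑ |E i (v i)|`, which is the weight required by the
    -- Hilbert space bound.
    have e1 : E j w - inner ℝ (R j) ((hΨL w).toLp _) =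
        ∑ u, β u * (sampleMean I (fun r => hofdBasis μ Ψ u (x r) * φhat w (x r))
          - ∫ z, hofdBasis μ Ψ u z * φhat w z ∂μ)
        + sampleMean I (fun r => e r * φhat w (x r))
        - ∑ i ∈ Finset.range j, (γ * E i (v i))
          * (sampleMean I (fun r => φhat (v i) (x r) * φhat w (x r))
            - ∫ z, φhat (v i) z * φhat w z ∂μ) := by
      rw [hin, hEj]
      simp only [mul_sub, Finset.sum_sub_distrib]
      ring
    obtain ⟨Z, hZ⟩ : ∃ Z, Z = t + ζ * (8 + 4 * B + T) := ⟨_, rfl⟩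
    have hZ1 : t + ζ * (8 + 4 * B) ≤ Z := by rw [hZ]; nlinarith [mul_nonneg hζ hT]
    have hZ2 : t + ζ * T ≤ Z := by
      rw [hZ]; nlinarith [mul_nonneg hζ hB0]
    rw [e1, ← hZ]
    have a1 : |∑ u, β u * (sampleMean I (fun r => hofdBasis μ Ψ u (x r) * φhat w (x r))
          - ∫ z, hofdBasis μ Ψ u z * φhat w z ∂μ)| ≤ K * Z := by
      calc _ ≤ ∑ u, |β u| * Z := (Finset.abs_sum_le_sum_abs _ _).trans
            (Finset.sum_le_sum fun u _ => by
              rw [abs_mul]; gcongr; exact (hcross u w).trans hZ1)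
        _ ≤ K * Z := by
            rw [← Finset.sum_mul]
            have : 0 ≤ Z := hZ ▸ hζ'
            gcongr
    have a2 : |∑ i ∈ Finset.range j, (γ * E i (v i))
          * (sampleMean I (fun r => φhat (v i) (x r) * φhat w (x r))
            - ∫ z, φhat (v i) z * φhat w z ∂μ)|
        ≤ (γ * ∑ i ∈ Finset.range j, |E i (v i)|) * Z := by
      rw [Finset.mul_sum, Finset.sum_mul]
      refine (Finset.abs_sum_le_sum_abs _ _).trans (Finset.sum_le_sum fun u _ => ?_)
      rw [abs_mul, abs_mul, abs_of_pos hγ]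
      gcongr
      exact ((hcross2 _ w).2).trans hZ1
    refine (abs_sub _ _).trans ((add_le_add ((abs_add_le _ _).trans
      (add_le_add a1 ((hnoise w).trans hZ2))) a2).trans (le_of_eq ?_))
    ring

/-! ### Events of probability tending to one, and uniform deviations in growing dimension. -/

section WithHighProb

variable {Ω : Type*} [MeasurableSpace Ω] {P : Measure Ω}

/-- The events `A n` have (outer) probability tending to one. -/
def WithHighProb (P : Measure Ω) (A : ℕ → Ω → Prop) : Prop :=
  Tendsto (fun n => P {ω | ¬ A n ω}) atTop (𝓝 0)

theorem WithHighProb.of_le {A : ℕ → Ω → Prop} {u : ℕ → ℝ} (hu : Tendsto u atTop (𝓝 0))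
    (h : ∀ᶠ n in atTop, P {ω | ¬ A n ω} ≤ ENNReal.ofReal (u n)) : WithHighProb P A := by
  have h0 : Tendsto (fun n => ENNReal.ofReal (u n)) atTop (𝓝 0) := by
    simpa using ENNReal.tendsto_ofReal hu
  exact tendsto_of_tendsto_of_tendsto_of_le_of_le' tendsto_const_nhds h0
    (Eventually.of_forall fun _ => zero_le) h

theorem WithHighProb.of_ae {A : ℕ → Ω → Prop} (h : ∀ n, ∀ᵐ ω ∂P, A n ω) : WithHighProb P A := by
  have : ∀ n, P {ω | ¬ A n ω} = 0 := fun n => ae_iff.1 (h n)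
  simp [WithHighProb, this]

theorem WithHighProb.and {A B : ℕ → Ω → Prop} (hA : WithHighProb P A) (hB : WithHighProb P B) :
    WithHighProb P fun n ω => A n ω ∧ B n ω := by
  have h := hA.add hB
  rw [add_zero] at h
  refine tendsto_of_tendsto_of_tendsto_of_le_of_le tendsto_const_nhds h
    (fun _ => zero_le) fun n => ?_
  refine (measure_mono fun ω hω => ?_).trans (measure_union_le _ _)
  simp only [Set.mem_union, Set.mem_ofPred_eq] at hω ⊢
  tauto

theorem WithHighProb.mono {A B : ℕ → Ω → Prop} (hA : WithHighProb P A)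
    (h : ∀ᶠ n in atTop, ∀ ω, A n ω → B n ω) : WithHighProb P B := by
  refine tendsto_of_tendsto_of_tendsto_of_le_of_le' tendsto_const_nhds hA
    (Eventually.of_forall fun _ => zero_le) ?_
  filter_upwards [h] with n hn
  exact measure_mono fun ω hω hA => hω (hn ω hA)

end WithHighProb

theorem tendsto_natCast_rpow_neg {s : ℝ} (hs : s < 0) :
    Tendsto (fun n : ℕ => (n : ℝ) ^ s) atTop (𝓝 0) := by
  have := (tendsto_rpow_neg_atTop (neg_pos.2 hs)).comp (tendsto_natCast_atTop_atTop (R := ℝ))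
  simpa [Function.comp_def] using this

theorem tendsto_natCast_rpow_atTop {s : ℝ} (hs : 0 < s) :
    Tendsto (fun n : ℕ => (n : ℝ) ^ s) atTop atTop :=
  (tendsto_rpow_atTop hs).comp (tendsto_natCast_atTop_atTop (R := ℝ))

/-- A polynomial in the dimension is beaten by the exponential tails. -/
theorem tendsto_pow_mul_exp_neg_rpow {p : ℕ → ℕ} {ξ c₀ : ℝ} (hξ : ξ ≤ 1)
    (hp : (fun n : ℕ => (p n : ℝ)) =O[atTop] fun n : ℕ => Real.exp (c₀ * (n : ℝ) ^ (1 - ξ)))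
    {c θ : ℝ} (hc : 0 < c) (hθ : 0 < θ) (A : ℝ) (m : ℕ) :
    Tendsto (fun n : ℕ => A * (p n : ℝ) ^ m * Real.exp (-(c * (n : ℝ) ^ (1 - ξ + θ)))) atTop
      (𝓝 0) := by
  obtain ⟨C₀, hC₀, hp⟩ := hp.exists_pos
  rw [Asymptotics.isBigOWith_iff] at hp
  -- After factoring out `n ^ (1 - ξ)`, which is at least `1`, the exponent gained from
  -- concentration exceeds the one from `p ^ m` by this quantity.
  have hlin : Tendsto (fun n : ℕ => c * (n : ℝ) ^ θ - m * c₀) atTop atTop :=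
    tendsto_atTop_add_const_right _ _ ((tendsto_natCast_rpow_atTop hθ).const_mul_atTop hc)
  have hlim : Tendsto (fun n : ℕ => |A| * C₀ ^ m * Real.exp (-(c * (n : ℝ) ^ θ - m * c₀))) atTop
      (𝓝 0) := by
    have := (Real.tendsto_exp_neg_atTop_nhds_zero.comp hlin).const_mul (|A| * C₀ ^ m)
    simpa [Function.comp_def] using this
  refine squeeze_zero_norm' ?_ hlim
  filter_upwards [hp, hlin.eventually_ge_atTop 0, eventually_ge_atTop 1] with n h1 h2 h3
  rw [Real.norm_eq_abs, Real.norm_eq_abs, Real.abs_exp, Nat.abs_cast] at h1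
  have hn : (1 : ℝ) ≤ n := by exact_mod_cast h3
  have hn1 : 1 ≤ (n : ℝ) ^ (1 - ξ) := Real.one_le_rpow hn (by linarith)
  rw [Real.norm_eq_abs, abs_mul, abs_mul, Real.abs_exp, abs_pow, Nat.abs_cast]
  calc |A| * (p n : ℝ) ^ m * Real.exp (-(c * (n : ℝ) ^ (1 - ξ + θ)))
      ≤ |A| * (C₀ * Real.exp (c₀ * (n : ℝ) ^ (1 - ξ))) ^ m
        * Real.exp (-(c * (n : ℝ) ^ (1 - ξ + θ))) := by gcongr
    _ = |A| * C₀ ^ m * Real.exp (-((n : ℝ) ^ (1 - ξ) * (c * (n : ℝ) ^ θ - m * c₀))) := by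
        rw [mul_pow, ← Real.exp_nat_mul, mul_assoc, mul_assoc, mul_assoc, ← Real.exp_add,
          Real.rpow_add (by linarith)]
        ring_nf
    _ ≤ _ := by
        gcongr
        nlinarith

section Uniform

variable {Ω : Type*} [MeasurableSpace Ω] {P : Measure Ω}

/-- Uniform concentration of empirical means over families of polynomial size in the dimension. -/
theorem withHighProb_sampleMean [IsProbabilityMeasure P] {p : ℕ → ℕ} {ξ c₀ : ℝ} (hξ : ξ ≤ 1)
    (hp : (fun n : ℕ => (p n : ℝ)) =O[atTop] fun n : ℕ => Real.exp (c₀ * (n : ℝ) ^ (1 - ξ)))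
    {S W : ℕ → Type} [∀ n, MeasurableSpace (S n)] [∀ n, Fintype (W n)]
    {ρ : (n : ℕ) → Measure (S n)} [∀ n, IsProbabilityMeasure (ρ n)]
    {Z : (n : ℕ) → ℕ → Ω → S n} (hlaw : ∀ n r, r < n → HasLaw (Z n r) (ρ n) P)
    (hindep : ∀ n, iIndepFun (fun (r : Fin n) ω => Z n r ω) P)
    {I : ℕ → Finset ℕ} (hI : ∀ n, ∀ r ∈ I n, r < n)
    (hIcard : ∀ᶠ n : ℕ in atTop, (n : ℝ) / 4 ≤ (I n).card)
    {D : ℝ} {m : ℕ} (hW : ∀ n, (Fintype.card (W n) : ℝ) ≤ D * (p n : ℝ) ^ m)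
    {f : (n : ℕ) → W n → S n → ℝ} {b s a ℓ : ℕ → ℝ} (hf : ∀ n w, AEMeasurable (f n w) (ρ n))
    (hfb : ∀ᶠ n in atTop, ∀ w, ∀ᵐ x ∂(ρ n), |f n w x| ≤ b n)
    (hfs : ∀ᶠ n in atTop, ∀ w, ∫ x, f n w x ^ 2 ∂(ρ n) ≤ s n) (hℓ : ∀ n, 0 ≤ ℓ n) {A θ : ℝ}
    (hA : 0 < A) (hθ : 0 < θ) (hb : ∀ᶠ n in atTop, ℓ n * (2 * b n) ≤ A)
    (hs : ∀ᶠ n in atTop, 2 * (ℓ n * s n) ≤ A * a n)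
    (hℓa : ∀ᶠ n : ℕ in atTop, ℓ n * a n = (n : ℝ) ^ (-ξ + θ)) :
    WithHighProb P fun n ω => ∀ w,
      |sampleMean (I n) (fun r => f n w (Z n r ω)) - ∫ x, f n w x ∂(ρ n)| ≤ a n := by
  -- The Laplace parameter is `ℓ n / A`. With at least `n / 4` points the exponent is at least `n /
  -- 4 * (n ^ (-ξ + θ) / A) / 2`, whence `1 / (8 * A)`.
  refine WithHighProb.of_le
    (tendsto_pow_mul_exp_neg_rpow hξ hp (c := 1 / (8 * A)) (θ := θ) (by positivity) hθ (2 * D) m) ?_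
  filter_upwards [hfb, hfs, hb, hs, hℓa, hIcard, eventually_ge_atTop 1] with n h1 h2 h3 h4 h5 h6 h7
  have hn : (1 : ℝ) ≤ n := by exact_mod_cast h7
  have hcard : 0 < (I n).card := by
    have : (0 : ℝ) < (I n).card := lt_of_lt_of_le (by linarith) h6
    exact_mod_cast this
  have h := measure_exists_sampleMean_sub_ge_le (t := ℓ n / A) (a := a n) (hlaw n) (hindep n)
    (hI n) hcard (hf n) h1 h2 (div_nonneg (hℓ n) hA.le)
    (by rw [div_mul_eq_mul_div, div_le_one hA]; exact h3)
    (by rw [div_mul_eq_mul_div, ← mul_div_assoc, div_le_iff₀ hA, mul_comm (a n)]; exact h4)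
  refine (measure_mono fun ω hω => ?_).trans (h.trans (ENNReal.ofReal_le_ofReal ?_))
  · simp only [Set.mem_ofPred_eq, not_forall, not_le] at hω ⊢
    obtain ⟨w, hw⟩ := hω
    exact ⟨w, hw.le⟩
  · have e : ℓ n / A * a n = (n : ℝ) ^ (-ξ + θ) / A := by rw [div_mul_eq_mul_div, h5]
    have e2 : (n : ℝ) ^ (1 - ξ + θ) = n * (n : ℝ) ^ (-ξ + θ) := by
      rw [sub_eq_add_neg, add_assoc, Real.rpow_add (by linarith), Real.rpow_one]
    rw [e, mul_assoc 2 D]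
    have hpos : 0 ≤ (n : ℝ) ^ (-ξ + θ) / A := by positivity
    gcongr
    · exact mul_nonneg zero_le_two ((Nat.cast_nonneg _).trans (hW n))
    · exact hW n
    · rw [e2]
      calc 1 / (8 * A) * (n * (n : ℝ) ^ (-ξ + θ)) = n / 4 * ((n : ℝ) ^ (-ξ + θ) / A) / 2 := by
            field_simp; ring
        _ ≤ _ := by gcongr

/-- Markov's inequality for the moment of order `q` and a union over `n` variables give `n * n ^
(-(q * τ))`. -/
theorem withHighProb_abs_le_rpow {ν : Measure ℝ} [IsProbabilityMeasure ν] {q τ : ℝ} (hq : 0 < q)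
    (hqτ : 1 < q * τ) (hνq : Integrable (fun e => |e| ^ q) ν)
    {ε : ℕ → ℕ → Ω → ℝ} (hlaw : ∀ n r, r < n → HasLaw (ε n r) ν P) :
    WithHighProb P fun n ω => ∀ r, r < n → |ε n r ω| ≤ (n : ℝ) ^ τ := by
  have hlim : Tendsto (fun n : ℕ => (∫ e, |e| ^ q ∂ν) * (n : ℝ) ^ (1 - q * τ)) atTop (𝓝 0) := by
    simpa using (tendsto_natCast_rpow_neg (s := 1 - q * τ) (by linarith)).const_mul
      (∫ e, |e| ^ q ∂ν)
  refine WithHighProb.of_le hlim ?_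
  filter_upwards [eventually_ge_atTop 1] with n hn
  have hn0 : (0 : ℝ) < n := by exact_mod_cast hn
  have htail : ν {e | ¬ |e| ≤ (n : ℝ) ^ τ} ≤
      ENNReal.ofReal ((∫ e, |e| ^ q ∂ν) * (n : ℝ) ^ (-(q * τ))) := by
    have h := mul_meas_ge_le_integral_of_nonneg (μ := ν)
      (Eventually.of_forall fun e : ℝ => Real.rpow_nonneg (abs_nonneg e) q) hνq
      ((n : ℝ) ^ (q * τ))
    rw [← ofReal_measureReal]
    refine ENNReal.ofReal_le_ofReal ?_
    have hsub : ν.real {e | ¬ |e| ≤ (n : ℝ) ^ τ} ≤ ν.real {e | (n : ℝ) ^ (q * τ) ≤ |e| ^ q} := by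
      refine measureReal_mono fun e he => ?_
      simp only [Set.mem_ofPred_eq, not_le] at he ⊢
      rw [mul_comm, Real.rpow_mul hn0.le]
      gcongr
    rw [Real.rpow_neg hn0.le, ← div_eq_mul_inv, le_div_iff₀ (by positivity), mul_comm]
    exact (mul_le_mul_of_nonneg_left hsub (by positivity)).trans h
  have hU : {ω | ¬ ∀ r, r < n → |ε n r ω| ≤ (n : ℝ) ^ τ} =
      ⋃ r ∈ Finset.range n, {ω | ¬ |ε n r ω| ≤ (n : ℝ) ^ τ} := by
    ext ω; simp
  rw [hU]
  calc P (⋃ r ∈ Finset.range n, {ω | ¬ |ε n r ω| ≤ (n : ℝ) ^ τ})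
      ≤ ∑ r ∈ Finset.range n, P {ω | ¬ |ε n r ω| ≤ (n : ℝ) ^ τ} := measure_biUnion_finset_le _ _
    _ ≤ ∑ _r ∈ Finset.range n, ENNReal.ofReal ((∫ e, |e| ^ q ∂ν) * (n : ℝ) ^ (-(q * τ))) :=
        Finset.sum_le_sum fun r hr => by
          rw [(hlaw n r (Finset.mem_range.1 hr)).measure_eq (p := fun e => ¬ |e| ≤ (n : ℝ) ^ τ)
            ((measurableSet_le measurable_norm measurable_const).compl)]
          exact htail
    _ = _ := by
        rw [Finset.sum_const, Finset.card_range, nsmul_eq_mul, ← ENNReal.ofReal_natCast,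
          ← ENNReal.ofReal_mul hn0.le, sub_eq_add_neg, Real.rpow_add hn0, Real.rpow_one]
        congr 1; ring

/-- A bound growing like a small power of `n` suffices later, so Markov's inequality is enough. -/
theorem withHighProb_sampleMean_abs_le [IsProbabilityMeasure P] {ν : Measure ℝ} [IsProbabilityMeasure ν]
    (hν : Integrable (fun e => |e|) ν) {ε : ℕ → ℕ → Ω → ℝ}
    (hlaw : ∀ n r, r < n → HasLaw (ε n r) ν P) {I : ℕ → Finset ℕ} (hI : ∀ n, ∀ r ∈ I n, r < n)
    {η : ℝ} (hη : 0 < η) :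
    WithHighProb P fun n ω => sampleMean (I n) (fun r => |ε n r ω|) ≤ (n : ℝ) ^ η := by
  have hlim : Tendsto (fun n : ℕ => (∫ e, |e| ∂ν) * (n : ℝ) ^ (-η)) atTop (𝓝 0) := by
    simpa using (tendsto_natCast_rpow_neg (s := -η) (by linarith)).const_mul (∫ e, |e| ∂ν)
  refine WithHighProb.of_le hlim ?_
  filter_upwards [eventually_ge_atTop 1] with n hn
  have hn0 : (0 : ℝ) < n := by exact_mod_cast hn
  have hint : ∀ r ∈ I n, Integrable (fun ω => |ε n r ω|) P := fun r hr => by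
    have hl := hlaw n r (hI n r hr)
    rw [← hl.map_eq] at hν
    exact hν.comp_aemeasurable hl.aemeasurable
  have hmean : ∫ ω, sampleMean (I n) (fun r => |ε n r ω|) ∂P ≤ ∫ e, |e| ∂ν := by
    simp only [sampleMean]
    rw [integral_const_mul, integral_finsetSum _ hint]
    have e : ∀ r ∈ I n, ∫ ω, |ε n r ω| ∂P = ∫ e, |e| ∂ν := fun r hr =>
      (hlaw n r (hI n r hr)).integral_comp (f := fun e => |e|) hν.1
    rw [Finset.sum_congr rfl e, Finset.sum_const, nsmul_eq_mul, ← mul_assoc]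
    have h0 : 0 ≤ ∫ e, |e| ∂ν := integral_nonneg fun e => abs_nonneg e
    -- Only an inequality, because `I n` may be empty and the inverse is then zero.
    exact mul_le_of_le_one_left h0 (inv_mul_le_one)
  have hmint : Integrable (fun ω => sampleMean (I n) (fun r => |ε n r ω|)) P := by
    simp only [sampleMean]
    exact (integrable_finsetSum _ hint).const_mul _
  have h := mul_meas_ge_le_integral_of_nonneg (μ := P)
    (Eventually.of_forall fun ω => by
      simp only [sampleMean, Pi.zero_apply]; positivity) hmint ((n : ℝ) ^ η)
  rw [← ofReal_measureReal]
  refine ENNReal.ofReal_le_ofReal ?_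
  have hsub : P.real {ω | ¬ sampleMean (I n) (fun r => |ε n r ω|) ≤ (n : ℝ) ^ η} ≤
      P.real {ω | (n : ℝ) ^ η ≤ sampleMean (I n) (fun r => |ε n r ω|)} := by
    refine measureReal_mono fun ω hω => ?_
    simp only [Set.mem_ofPred_eq, not_le] at hω ⊢
    exact hω.le
  rw [Real.rpow_neg hn0.le, ← div_eq_mul_inv, le_div_iff₀ (by positivity), mul_comm]
  exact ((mul_le_mul_of_nonneg_left hsub (by positivity)).trans h).trans hmean

end Uniform

/-! ### Size of the dictionary, dependence of the bounds on `n`, truncation of the noise. -/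

theorem card_dictIdx_le {p L : ℕ} (hp : 1 ≤ p) (hL : 1 ≤ L) :
    (Fintype.card (DictIdx p L) : ℝ) ≤ 2 * L ^ 2 * (p : ℝ) ^ 2 := by
  have h : Fintype.card (DictIdx p L) ≤ 2 * L ^ 2 * p ^ 2 := by
    have h1 : Fintype.card {ij : Fin p × Fin p // ij.1 < ij.2} ≤ p * p := by
      simpa using Fintype.card_subtype_le fun ij : Fin p × Fin p => ij.1 < ij.2
    rw [Fintype.card_sum, Fintype.card_prod, Fintype.card_prod, Fintype.card_prod,
      Fintype.card_fin, Fintype.card_fin]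
    have h2 : p * L ≤ p * L * (p * L) := Nat.le_mul_of_pos_right _ (by positivity)
    have h3 := Nat.mul_le_mul_right (L * L) h1
    nlinarith
  exact_mod_cast h

theorem gramBdd_of_le_det {p L : ℕ} {μ : Measure (Fin p → ℝ)} [IsProbabilityMeasure μ]
    {Ψ : Fin p → Fin (L + 1) → ℝ → ℝ} {M κ : ℝ} (hM : 1 ≤ M)
    (hΨ : ∀ i, IsOrthonormalSystem (μ.map fun x => x i) (Ψ i))
    (hbdd : ∀ i (l : Fin L), ∀ᵐ x ∂μ, |phiOne Ψ i l x| ≤ M) (hκ : 0 < κ)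
    (hdet : ∀ i j : Fin p, i ≠ j → κ ≤ (gramA (expect μ) Ψ i j).det) :
    GramBdd μ Ψ M ((L + L : ℕ) * ((L + L).factorial * (M ^ 2) ^ (L + L)) / κ) where
  one_le := hM
  nonneg := by positivity
  orthonormal := hΨ
  bdd := ae_firstOrderBdd hbdd
  det_ne_zero i j hij := (hκ.trans_le (hdet i j hij)).ne'
  norm_le i j hij v := by
    have h := norm_le_mul_norm_mulVec_of_le_det (one_le_pow₀ hM)
      (abs_gramA_expect_le (ae_firstOrderBdd hbdd) i j) hκ (hdet i j hij) v
    simpa only [Fintype.card_sum, Fintype.card_fin] using h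

theorem dictBound_mul_le {L : ℕ} {M Λ x : ℝ} (hx : 1 ≤ x) :
    dictBound L M (Λ * x) ≤ dictBound L M Λ * x := by
  have h : M ^ 2 ≤ M ^ 2 * x := le_mul_of_one_le_right (sq_nonneg M) hx
  unfold dictBound
  linarith

/-- The identity cut off outside `[-R, R]`. -/
noncomputable def cutoff (R e : ℝ) : ℝ := if |e| ≤ R then e else 0

theorem measurable_cutoff (R : ℝ) : Measurable (cutoff R) :=
  Measurable.ite (measurableSet_le measurable_norm measurable_const) measurable_id
    measurable_const

theorem abs_cutoff_le {R : ℝ} (hR : 0 ≤ R) (e : ℝ) : |cutoff R e| ≤ R := by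
  unfold cutoff; split_ifs with h
  · exact h
  · simpa using hR

theorem cutoff_sq_le (R e : ℝ) : cutoff R e ^ 2 ≤ e ^ 2 := by
  unfold cutoff; split_ifs
  · exact le_rfl
  · rw [zero_pow two_ne_zero]; exact sq_nonneg e

theorem cutoff_of_le {R e : ℝ} (h : |e| ≤ R) : cutoff R e = e := if_pos h

theorem withHighProb_firstOrderBdd {Ω : Type*} [MeasurableSpace Ω] {P : Measure Ω} {L : ℕ}
    {p : ℕ → ℕ} {μ : (n : ℕ) → Measure (Fin (p n) → ℝ)}
    {Ψ : (n : ℕ) → Fin (p n) → Fin (L + 1) → ℝ → ℝ} {M : ℝ}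
    {X : (n : ℕ) → ℕ → Ω → Fin (p n) → ℝ} {I : ℕ → Finset ℕ} (hlaw : ∀ n r, r < n → HasLaw (X n r) (μ n) P)
    (hI : ∀ n, ∀ r ∈ I n, r < n) (hbdd : ∀ n, ∀ᵐ x ∂(μ n), FirstOrderBdd (Ψ n) M x) :
    WithHighProb P fun n ω => ∀ r ∈ I n, FirstOrderBdd (Ψ n) M (X n r ω) := by
  refine WithHighProb.of_ae fun n => (ae_ball_iff (I n).countable_toSet).2 fun r hr => ?_
  have hl := hlaw n r (hI n r hr)
  have h := hbdd n
  rw [← hl.map_eq] at h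
  exact ae_of_ae_map hl.aemeasurable h

/-! ### The deviation events have probability tending to one. -/

section Deviations

variable {Ω : Type*} [MeasurableSpace Ω] {P : Measure Ω} [IsProbabilityMeasure P] {L : ℕ}
  {p : ℕ → ℕ} {μ : (n : ℕ) → Measure (Fin (p n) → ℝ)} [∀ n, IsProbabilityMeasure (μ n)]
  {Ψ : (n : ℕ) → Fin (p n) → Fin (L + 1) → ℝ → ℝ} {M Λ B ξ ϑ c₀ η : ℝ}
  {X : (n : ℕ) → ℕ → Ω → Fin (p n) → ℝ} {I : ℕ → Finset ℕ}

/-- Second moments are bounded independently of `n`, both for a dictionary function and for its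
product with a main effect. The sup norm, of order `n ^ ϑ`, intervenes only through `n ^ (-ξ / 2 +
η) * n ^ ϑ ≤ 1`, so the rate loses nothing to `ϑ`. -/
theorem withHighProb_dictDev (hL : 1 ≤ L) (hp : ∀ n, 1 ≤ p n)
    (hbdd : ∀ n, ∀ᵐ x ∂(μ n), FirstOrderBdd (Ψ n) M x)
    (hΨ : ∀ n i, IsOrthonormalSystem ((μ n).map fun x => x i) (Ψ n i))
    (hg : ∀ n : ℕ, 1 ≤ n → GramBdd (μ n) (Ψ n) M (Λ * (n : ℝ) ^ ϑ))
    (hB : ∀ n v, ∫ x, hofdBasis (μ n) (Ψ n) v x ^ 2 ∂(μ n) ≤ B) (hM : 1 ≤ M) (hΛ : 0 ≤ Λ)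
    (hB0 : 0 ≤ B) (hξ1 : ξ ≤ 1) (hϑ0 : 0 ≤ ϑ) (hη0 : 0 < η) (hη : η ≤ ξ / 2 - ϑ)
    (hpO : (fun n : ℕ => (p n : ℝ)) =O[atTop] fun n : ℕ => Real.exp (c₀ * (n : ℝ) ^ (1 - ξ)))
    (hlaw : ∀ n r, r < n → HasLaw (X n r) (μ n) P)
    (hindep : ∀ n, iIndepFun (fun (r : Fin n) ω => X n r ω) P)
    (hI : ∀ n, ∀ r ∈ I n, r < n) (hIcard : ∀ᶠ n : ℕ in atTop, (n : ℝ) / 4 ≤ (I n).card) :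
    WithHighProb P fun n ω =>
      DictDev (μ n) (Ψ n) M ((n : ℝ) ^ (-ξ / 2 + η)) (I n) fun r => X n r ω := by
  have hD0 : 0 ≤ dictBound L M Λ := by unfold dictBound; positivity
  have hφm : ∀ n v, AEMeasurable (hofdBasis (μ n) (Ψ n) v) (μ n) := fun n v =>
    (aestronglyMeasurable_hofdBasis (hΨ n) v).aemeasurable
  have hφb : ∀ n : ℕ, 1 ≤ n → ∀ v, ∀ᵐ x ∂(μ n),
      |hofdBasis (μ n) (Ψ n) v x| ≤ dictBound L M Λ * (n : ℝ) ^ ϑ := fun n hn v => by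
    filter_upwards [hbdd n] with x hx
    exact ((hg n hn).abs_hofdBasis_le v hx).trans
      (dictBound_mul_le (Real.one_le_rpow (by exact_mod_cast hn) hϑ0))
  have hℓ : ∀ n : ℕ, 0 ≤ (n : ℝ) ^ (-ξ / 2 + η) := fun n => by positivity
  have hℓa : ∀ᶠ n : ℕ in atTop,
      (n : ℝ) ^ (-ξ / 2 + η) * (n : ℝ) ^ (-ξ / 2 + η) = (n : ℝ) ^ (-ξ + 2 * η) := by
    filter_upwards [eventually_ge_atTop 1] with n hn
    rw [← Real.rpow_add (by exact_mod_cast hn)]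
    ring_nf
  have hℓb : ∀ n : ℕ, 1 ≤ n → (n : ℝ) ^ (-ξ / 2 + η) * (n : ℝ) ^ ϑ ≤ 1 := fun n hn => by
    have hn1 : (1 : ℝ) ≤ n := by exact_mod_cast hn
    rw [← Real.rpow_add (by linarith)]
    exact Real.rpow_le_one_of_one_le_of_nonpos hn1 (by linarith)
  have h1 := withHighProb_sampleMean (S := fun n => Fin (p n) → ℝ) (W := fun n => DictIdx (p n) L)
    hξ1 hpO hlaw hindep hI hIcard (D := 2 * L ^ 2) (m := 2)
    (fun n => card_dictIdx_le (hp n) hL) (f := fun n v x => hofdBasis (μ n) (Ψ n) v x)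
    (b := fun n => dictBound L M Λ * (n : ℝ) ^ ϑ) (s := fun _ => B)
    (a := fun n => (n : ℝ) ^ (-ξ / 2 + η)) (ℓ := fun n => (n : ℝ) ^ (-ξ / 2 + η)) hφm
    (by filter_upwards [eventually_ge_atTop 1] with n hn using hφb n hn)
    (Eventually.of_forall fun n v => hB n v) hℓ (A := 2 * dictBound L M Λ + 2 * B + 1)
    (θ := 2 * η) (by positivity) (by positivity)
    (by
      filter_upwards [eventually_ge_atTop 1] with n hn
      nlinarith [mul_le_mul_of_nonneg_left (hℓb n hn) hD0])
    (Eventually.of_forall fun n => by nlinarith [hℓ n, mul_nonneg hD0 (hℓ n)]) hℓa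
  have h2 := withHighProb_sampleMean (S := fun n => Fin (p n) → ℝ)
    (W := fun n => DictIdx (p n) L × (Fin (p n) × Fin L))
    hξ1 hpO hlaw hindep hI hIcard (D := 2 * L ^ 3) (m := 3)
    (fun n => by
      have := card_dictIdx_le (hp n) hL
      rw [Fintype.card_prod, Fintype.card_prod, Fintype.card_fin, Fintype.card_fin]
      push_cast
      calc (Fintype.card (DictIdx (p n) L) : ℝ) * (p n * L)
          ≤ 2 * L ^ 2 * (p n : ℝ) ^ 2 * (p n * L) := by gcongr
        _ = _ := by ring)
    (f := fun n v x => hofdBasis (μ n) (Ψ n) v.1 x * phiOne (Ψ n) v.2.1 v.2.2 x)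
    (b := fun n => dictBound L M Λ * (n : ℝ) ^ ϑ * M) (s := fun _ => B * M ^ 2)
    (a := fun n => (n : ℝ) ^ (-ξ / 2 + η)) (ℓ := fun n => (n : ℝ) ^ (-ξ / 2 + η))
    (fun n v => (hφm n v.1).mul (aestronglyMeasurable_phiOne (hΨ n) v.2.1 v.2.2).aemeasurable)
    (by
      filter_upwards [eventually_ge_atTop 1] with n hn v
      filter_upwards [hφb n hn v.1, hbdd n] with x h1 h2
      rw [abs_mul]
      gcongr
      exact h2 _ _)
    (by
      filter_upwards [eventually_ge_atTop 1] with n hn v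
      have hint : Integrable (fun x => hofdBasis (μ n) (Ψ n) v.1 x ^ 2 * M ^ 2) (μ n) := by
        refine Integrable.mul_const ?_ _
        simp only [sq]
        exact integrable_mul_of_firstOrderBdd (hbdd n) (aestronglyMeasurable_hofdBasis (hΨ n) v.1)
          (aestronglyMeasurable_hofdBasis (hΨ n) v.1)
          (fun _ hx => (hg n hn).abs_hofdBasis_le v.1 hx)
          (fun _ hx => (hg n hn).abs_hofdBasis_le v.1 hx)
      refine (integral_mono_of_nonneg (Eventually.of_forall fun x => sq_nonneg _) hint ?_).trans ?_
      · filter_upwards [hbdd n] with x hx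
        rw [mul_pow]
        exact mul_le_mul_of_nonneg_left (sq_le_sq' (abs_le.1 (hx _ _)).1 (abs_le.1 (hx _ _)).2)
          (sq_nonneg _)
      · rw [integral_mul_const]
        gcongr
        exact hB n v.1)
    hℓ (A := 2 * dictBound L M Λ * M + 2 * (B * M ^ 2) + 1)
    (θ := 2 * η) (by positivity) (by positivity)
    (by
      filter_upwards [eventually_ge_atTop 1] with n hn
      have := mul_le_mul_of_nonneg_left (hℓb n hn) (mul_nonneg hD0 (by linarith : 0 ≤ M))
      have h3 : 0 ≤ B * M ^ 2 := by positivity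
      nlinarith)
    (Eventually.of_forall fun n => by
      have h3 : 0 ≤ dictBound L M Λ * M * (n : ℝ) ^ (-ξ / 2 + η) := by positivity
      nlinarith [hℓ n]) hℓa
  refine (((withHighProb_firstOrderBdd hlaw hI hbdd).and (h1.and h2))).mono
    (Eventually.of_forall fun n ω h => ?_)
  exact ⟨h.1, h.2.1, fun v i l => h.2.2 (v, (i, l))⟩

/-- Products of two dictionary functions have second moments of order `n ^ (2 * ϑ)`, so the
deviation level `a` is raised by `n ^ ϑ` and the Laplace parameter `ℓ` lowered by as much; the
product `ℓ * a`, which governs the exponent, is unchanged. -/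
theorem withHighProb_boostDev {ν : Measure ℝ} [IsProbabilityMeasure ν] {q τ : ℝ}
    {ε : ℕ → ℕ → Ω → ℝ} (hL : 1 ≤ L) (hp : ∀ n, 1 ≤ p n)
    (hbdd : ∀ n, ∀ᵐ x ∂(μ n), FirstOrderBdd (Ψ n) M x)
    (hΨ : ∀ n i, IsOrthonormalSystem ((μ n).map fun x => x i) (Ψ n i))
    (hg : ∀ n : ℕ, 1 ≤ n → GramBdd (μ n) (Ψ n) M (Λ * (n : ℝ) ^ ϑ))
    (hB : ∀ n v, ∫ x, hofdBasis (μ n) (Ψ n) v x ^ 2 ∂(μ n) ≤ B) (hM : 1 ≤ M) (hΛ : 0 ≤ Λ)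
    (hB0 : 0 ≤ B) (hξ1 : ξ ≤ 1) (hϑ0 : 0 ≤ ϑ) (hη0 : 0 < η) (hη : η ≤ ξ / 2 - ϑ)
    (hητ : η ≤ ξ / 2 - τ) (hqτ : 1 < q * τ) (hq : 2 ≤ q)
    (hνq : Integrable (fun e => |e| ^ q) ν)
    (hpO : (fun n : ℕ => (p n : ℝ)) =O[atTop] fun n : ℕ => Real.exp (c₀ * (n : ℝ) ^ (1 - ξ)))
    (hlaw : ∀ n r, r < n → HasLaw (fun ω => (X n r ω, ε n r ω)) ((μ n).prod ν) P)
    (hindep : ∀ n, iIndepFun (fun (r : Fin n) ω => (X n r ω, ε n r ω)) P)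
    (hI : ∀ n, ∀ r ∈ I n, r < n) (hIcard : ∀ᶠ n : ℕ in atTop, (n : ℝ) / 4 ≤ (I n).card) :
    WithHighProb P fun n ω => BoostDev (μ n) (Ψ n) M ((n : ℝ) ^ (ϑ - ξ / 2 + η)) ((n : ℝ) ^ η)
      (I n) (fun r => X n r ω) fun r => ε n r ω := by
  have hlawX : ∀ n r, r < n → HasLaw (X n r) (μ n) P := fun n r hr =>
    HasLaw.fun_comp (Y := Prod.fst) ⟨measurable_fst.aemeasurable, by
      rw [Measure.map_fst_prod]; simp⟩ (hlaw n r hr)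
  have hlawε : ∀ n r, r < n → HasLaw (ε n r) ν P := fun n r hr =>
    HasLaw.fun_comp (Y := Prod.snd) ⟨measurable_snd.aemeasurable, by
      rw [Measure.map_snd_prod]; simp⟩ (hlaw n r hr)
  have hindepX : ∀ n, iIndepFun (fun (r : Fin n) ω => X n r ω) P := fun n =>
    (hindep n).comp (fun _ => Prod.fst) fun _ => measurable_fst
  set D := dictBound L M Λ with hD
  have hD0 : 0 ≤ D := by rw [hD]; unfold dictBound; positivity
  have hφm : ∀ n v, AEMeasurable (hofdBasis (μ n) (Ψ n) v) (μ n) := fun n v =>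
    (aestronglyMeasurable_hofdBasis (hΨ n) v).aemeasurable
  have hφb : ∀ n : ℕ, 1 ≤ n → ∀ v, ∀ᵐ x ∂(μ n),
      |hofdBasis (μ n) (Ψ n) v x| ≤ D * (n : ℝ) ^ ϑ := fun n hn v => by
    filter_upwards [hbdd n] with x hx
    exact ((hg n hn).abs_hofdBasis_le v hx).trans
      (dictBound_mul_le (Real.one_le_rpow (by exact_mod_cast hn) hϑ0))
  have hint2 : ∀ n : ℕ, 1 ≤ n → ∀ v, Integrable (fun x => hofdBasis (μ n) (Ψ n) v x ^ 2) (μ n) :=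
    fun n hn v => by
      simp only [sq]
      exact integrable_mul_of_firstOrderBdd (hbdd n) (aestronglyMeasurable_hofdBasis (hΨ n) v)
        (aestronglyMeasurable_hofdBasis (hΨ n) v)
        (fun _ hx => (hg n hn).abs_hofdBasis_le v hx)
        (fun _ hx => (hg n hn).abs_hofdBasis_le v hx)
  have hν2 : Integrable (fun e : ℝ => e ^ 2) ν := by
    refine ((integrable_const (1 : ℝ)).add hνq).mono' (measurable_id.pow_const 2).aestronglyMeasurable
      (Eventually.of_forall fun e => ?_)
    rw [Real.norm_eq_abs, abs_pow, Pi.add_apply]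
    rcases le_total |e| 1 with h | h
    · have h1 : |e| ^ 2 ≤ 1 := pow_le_one₀ (abs_nonneg e) h
      have h2 : 0 ≤ |e| ^ q := by positivity
      linarith
    · have h1 : |e| ^ 2 ≤ |e| ^ q := by
        rw [← Real.rpow_natCast]
        exact Real.rpow_le_rpow_of_exponent_le h (by exact_mod_cast hq)
      linarith
  have hν1 : Integrable (fun e : ℝ => |e|) ν := by
    refine ((integrable_const (1 : ℝ)).add hν2).mono' measurable_norm.aestronglyMeasurable
      (Eventually.of_forall fun e => ?_)
    rw [Real.norm_eq_abs, abs_abs, Pi.add_apply]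
    nlinarith [sq_abs e, sq_nonneg (|e| - 1)]
  set V := ∫ e, e ^ 2 ∂ν with hV
  have hV0 : 0 ≤ V := integral_nonneg fun e => sq_nonneg e
  have hℓ : ∀ n : ℕ, 0 ≤ (n : ℝ) ^ (-ϑ - ξ / 2 + η) := fun n => by positivity
  have ha : ∀ n : ℕ, 0 ≤ (n : ℝ) ^ (ϑ - ξ / 2 + η) := fun n => by positivity
  have hℓa : ∀ᶠ n : ℕ in atTop,
      (n : ℝ) ^ (-ϑ - ξ / 2 + η) * (n : ℝ) ^ (ϑ - ξ / 2 + η) = (n : ℝ) ^ (-ξ + 2 * η) := by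
    filter_upwards [eventually_ge_atTop 1] with n hn
    rw [← Real.rpow_add (by exact_mod_cast hn)]
    ring_nf
  have hℓϑ : ∀ n : ℕ, 1 ≤ n → (n : ℝ) ^ (-ϑ - ξ / 2 + η) * ((n : ℝ) ^ ϑ * (n : ℝ) ^ ϑ)
      = (n : ℝ) ^ (ϑ - ξ / 2 + η) := fun n hn => by
    have hn1 : (0 : ℝ) < n := by exact_mod_cast hn
    rw [← Real.rpow_add hn1, ← Real.rpow_add hn1]
    ring_nf
  have ha1 : ∀ n : ℕ, 1 ≤ n → (n : ℝ) ^ (ϑ - ξ / 2 + η) ≤ 1 := fun n hn =>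
    Real.rpow_le_one_of_one_le_of_nonpos (by exact_mod_cast hn) (by linarith)
  have hℓle : ∀ n : ℕ, 1 ≤ n → (n : ℝ) ^ (-ϑ - ξ / 2 + η) ≤ (n : ℝ) ^ (ϑ - ξ / 2 + η) :=
    fun n hn => Real.rpow_le_rpow_of_exponent_le (by exact_mod_cast hn) (by linarith)
  have hℓτ : ∀ n : ℕ, 1 ≤ n →
      (n : ℝ) ^ (-ϑ - ξ / 2 + η) * ((n : ℝ) ^ ϑ * (n : ℝ) ^ τ) ≤ 1 := fun n hn => by
    have hn1 : (1 : ℝ) ≤ n := by exact_mod_cast hn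
    rw [← Real.rpow_add (by linarith), ← Real.rpow_add (by linarith)]
    exact Real.rpow_le_one_of_one_le_of_nonpos hn1 (by linarith)
  have h1 := withHighProb_sampleMean (S := fun n => Fin (p n) → ℝ)
    (W := fun n => DictIdx (p n) L × DictIdx (p n) L)
    hξ1 hpO hlawX hindepX hI hIcard (D := 4 * L ^ 4) (m := 4)
    (fun n => by
      have := card_dictIdx_le (hp n) hL
      rw [Fintype.card_prod]
      push_cast
      calc (Fintype.card (DictIdx (p n) L) : ℝ) * Fintype.card (DictIdx (p n) L)
          ≤ 2 * L ^ 2 * (p n : ℝ) ^ 2 * (2 * L ^ 2 * (p n : ℝ) ^ 2) := by gcongr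
        _ = _ := by ring)
    (f := fun n v x => hofdBasis (μ n) (Ψ n) v.1 x * hofdBasis (μ n) (Ψ n) v.2 x)
    (b := fun n => D * (n : ℝ) ^ ϑ * (D * (n : ℝ) ^ ϑ))
    (s := fun n => B * (D * (n : ℝ) ^ ϑ) ^ 2)
    (a := fun n => (n : ℝ) ^ (ϑ - ξ / 2 + η)) (ℓ := fun n => (n : ℝ) ^ (-ϑ - ξ / 2 + η))
    (fun n v => (hφm n v.1).mul (hφm n v.2))
    (by
      filter_upwards [eventually_ge_atTop 1] with n hn v
      filter_upwards [hφb n hn v.1, hφb n hn v.2] with x h1 h2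
      rw [abs_mul]
      gcongr)
    (by
      filter_upwards [eventually_ge_atTop 1] with n hn v
      refine (integral_mono_of_nonneg (Eventually.of_forall fun x => sq_nonneg _)
        ((hint2 n hn v.1).mul_const ((D * (n : ℝ) ^ ϑ) ^ 2)) ?_).trans ?_
      · filter_upwards [hφb n hn v.2] with x hx
        rw [mul_pow]
        exact mul_le_mul_of_nonneg_left (sq_le_sq' (abs_le.1 hx).1 (abs_le.1 hx).2) (sq_nonneg _)
      · rw [integral_mul_const]
        gcongr
        exact hB n v.1)
    hℓ (A := 2 * D ^ 2 + 2 * (B * D ^ 2) + 1)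
    (θ := 2 * η) (by positivity) (by positivity)
    (by
      filter_upwards [eventually_ge_atTop 1] with n hn
      calc (n : ℝ) ^ (-ϑ - ξ / 2 + η) * (2 * (D * (n : ℝ) ^ ϑ * (D * (n : ℝ) ^ ϑ)))
          = 2 * D ^ 2 * ((n : ℝ) ^ (-ϑ - ξ / 2 + η) * ((n : ℝ) ^ ϑ * (n : ℝ) ^ ϑ)) := by ring
        _ ≤ 2 * D ^ 2 * 1 := by rw [hℓϑ n hn]; gcongr; exact ha1 n hn
        _ ≤ _ := by
          have : 0 ≤ B * D ^ 2 := by positivity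
          linarith)
    (by
      filter_upwards [eventually_ge_atTop 1] with n hn
      calc 2 * ((n : ℝ) ^ (-ϑ - ξ / 2 + η) * (B * (D * (n : ℝ) ^ ϑ) ^ 2))
          = 2 * (B * D ^ 2) * ((n : ℝ) ^ (-ϑ - ξ / 2 + η) * ((n : ℝ) ^ ϑ * (n : ℝ) ^ ϑ)) := by
            ring
        _ = 2 * (B * D ^ 2) * (n : ℝ) ^ (ϑ - ξ / 2 + η) := by rw [hℓϑ n hn]
        _ ≤ _ := by
          have := ha n
          gcongr
          nlinarith [sq_nonneg D]) hℓa
  -- The noise is truncated at `n ^ τ` to make the products bounded; with high probability no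
  -- observed noise is affected.
  have h2 := withHighProb_sampleMean (S := fun n => (Fin (p n) → ℝ) × ℝ)
    (W := fun n => DictIdx (p n) L) (ρ := fun n => (μ n).prod ν)
    (Z := fun n r ω => (X n r ω, ε n r ω)) hξ1 hpO hlaw hindep hI hIcard (D := 2 * L ^ 2) (m := 2)
    (fun n => card_dictIdx_le (hp n) hL)
    (f := fun n v z => hofdBasis (μ n) (Ψ n) v z.1 * cutoff ((n : ℝ) ^ τ) z.2)
    (b := fun n => D * (n : ℝ) ^ ϑ * (n : ℝ) ^ τ) (s := fun _ => B * V)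
    (a := fun n => (n : ℝ) ^ (ϑ - ξ / 2 + η)) (ℓ := fun n => (n : ℝ) ^ (-ϑ - ξ / 2 + η))
    (fun n v => ((aestronglyMeasurable_hofdBasis (hΨ n) v).comp_fst).aemeasurable.mul
      ((measurable_cutoff _).comp measurable_snd).aemeasurable)
    (by
      filter_upwards [eventually_ge_atTop 1] with n hn v
      have h := Measure.quasiMeasurePreserving_fst (μ := μ n) (ν := ν) |>.ae (hφb n hn v)
      filter_upwards [h] with x h1
      rw [abs_mul]
      gcongr
      exact abs_cutoff_le (by positivity) _)
    (by
      filter_upwards [eventually_ge_atTop 1] with n hn v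
      simp only [mul_pow]
      rw [integral_prod_mul (fun x => hofdBasis (μ n) (Ψ n) v x ^ 2)
        fun e => cutoff ((n : ℝ) ^ τ) e ^ 2]
      exact mul_le_mul (hB n v) (integral_mono_of_nonneg (Eventually.of_forall fun e => sq_nonneg _)
        hν2 (Eventually.of_forall fun e => cutoff_sq_le _ e))
        (integral_nonneg fun e => sq_nonneg _) hB0)
    hℓ (A := 2 * D + 2 * (B * V) + 1)
    (θ := 2 * η) (by positivity) (by positivity)
    (by
      filter_upwards [eventually_ge_atTop 1] with n hn
      calc (n : ℝ) ^ (-ϑ - ξ / 2 + η) * (2 * (D * (n : ℝ) ^ ϑ * (n : ℝ) ^ τ))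
          = 2 * D * ((n : ℝ) ^ (-ϑ - ξ / 2 + η) * ((n : ℝ) ^ ϑ * (n : ℝ) ^ τ)) := by ring
        _ ≤ 2 * D * 1 := by gcongr; exact hℓτ n hn
        _ ≤ _ := by
          have : 0 ≤ B * V := by positivity
          linarith)
    (by
      filter_upwards [eventually_ge_atTop 1] with n hn
      calc 2 * ((n : ℝ) ^ (-ϑ - ξ / 2 + η) * (B * V))
          = 2 * (B * V) * (n : ℝ) ^ (-ϑ - ξ / 2 + η) := by ring
        _ ≤ 2 * (B * V) * (n : ℝ) ^ (ϑ - ξ / 2 + η) := by exact mul_le_mul_of_nonneg_left (hℓle n hn) (by positivity)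
        _ ≤ _ := by
          have := ha n
          gcongr
          linarith) hℓa
  have h3 := withHighProb_abs_le_rpow (by linarith) hqτ hνq hlawε
  have h4 := withHighProb_sampleMean_abs_le hν1 hlawε hI hη0
  refine ((((withHighProb_firstOrderBdd hlawX hI hbdd).and (h1.and h2)).and (h3.and h4))).mono ?_
  filter_upwards [eventually_ge_atTop 1] with n hn ω h
  obtain ⟨⟨g0, g1, g2⟩, g3, g4⟩ := h
  refine ⟨g0, fun v w => g1 (v, w), fun v => ?_, g4⟩
  have h5 := g2 v
  -- Truncation may destroy the centering of the noise, but the dictionary functions are centered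
  -- and independent of it, so the product still has mean zero.
  rw [integral_prod_mul (fun x => hofdBasis (μ n) (Ψ n) v x) fun e => cutoff ((n : ℝ) ^ τ) e,
    (hg n hn).integral_hofdBasis, zero_mul, sub_zero] at h5
  rw [sampleMean_congr (b := fun r => hofdBasis (μ n) (Ψ n) v (X n r ω)
    * cutoff ((n : ℝ) ^ τ) (ε n r ω)) fun r hr => by
      rw [cutoff_of_le (g3 r (hI n r hr)), mul_comm]]
  exact h5

end Deviations

/-! ### Consistency: choice of the exponents and conclusion. -/

theorem theorem2
    {Ω : Type*} [MeasurableSpace Ω] (P : Measure Ω) [IsProbabilityMeasure P]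
    -- number `L` of basis functions per variable, number `p n` of variables, laws of the inputs
    (L : ℕ) (hL : 1 ≤ L)
    (p : ℕ → ℕ) (hp : ∀ n, 1 ≤ p n)
    (μ : (n : ℕ) → Measure (Fin (p n) → ℝ)) [∀ n, IsProbabilityMeasure (μ n)]
    (Ψ : (n : ℕ) → Fin (p n) → Fin (L + 1) → ℝ → ℝ)
    (hΨ : ∀ n i, IsOrthonormalSystem ((μ n).map fun x => x i) (Ψ n i))
    -- sparsity of the true parameter, uniformly in `n`
    (β : (n : ℕ) → DictIdx (p n) L → ℝ)
    (hs : ∃ K : ℝ, ∀ n, ∑ v, |β n v| ≤ K)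
    -- centered noise with a moment of order `q > 4 / ξ`
    (ξ ϑ q : ℝ) (hξ0 : 0 < ξ) (hξ1 : ξ ≤ 1) (hϑ0 : 0 ≤ ϑ) (hϑ : ϑ < ξ / 2) (hq : 4 / ξ < q)
    (ν : Measure ℝ) [IsProbabilityMeasure ν]
    (hν : ∫ e, e ∂ν = 0) (hνq : Integrable (fun e => |e| ^ q) ν)
    -- bounded basis functions, dimension, Gram determinants
    (hb1 : ∃ M : ℝ, ∀ n i (l : Fin L), ∀ᵐ x ∂(μ n), |phiOne (Ψ n) i l x| ≤ M)
    (hb2 : ∃ c : ℝ, 0 < c ∧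
      (fun n : ℕ => (p n : ℝ)) =O[atTop] fun n : ℕ => Real.exp (c * (n : ℝ) ^ (1 - ξ)))
    (hb3 : ∃ c : ℝ, 0 < c ∧ ∀ n : ℕ, 1 ≤ n → ∀ i j : Fin (p n), i ≠ j →
      c * (n : ℝ) ^ (-ϑ) ≤ (gramA (expect (μ n)) (Ψ n) i j).det)
    -- shrinkage parameter, and size of the dictionary functions
    (γ : ℝ) (hγ0 : 0 < γ) (hγ1 : γ ≤ 1)
    (hγ : ∃ B : ℝ, γ * B < 2 ∧ ∀ n v, ∫ x, (hofdBasis (μ n) (Ψ n) v x) ^ 2 ∂(μ n) ≤ B)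
    -- for each `n`, an i.i.d. sample of size `n`, with noise independent of the inputs
    (X : (n : ℕ) → ℕ → Ω → Fin (p n) → ℝ) (ε : ℕ → ℕ → Ω → ℝ)
    (hlaw : ∀ n r, r < n → HasLaw (fun ω => (X n r ω, ε n r ω)) ((μ n).prod ν) P)
    (hindep : ∀ n, iIndepFun (fun (r : Fin n) ω => (X n r ω, ε n r ω)) P)
    -- estimated dictionary from the first half, boosting on the second half
    (φhat : (n : ℕ) → Ω → DictIdx (p n) L → (Fin (p n) → ℝ) → ℝ)
    (hφhat : ∀ n ω, IsEHOFD (Finset.range (n / 2)) (fun r => X n r ω) (Ψ n) (φhat n ω))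
    (G : (n : ℕ) → Ω → ℕ → (Fin (p n) → ℝ) → ℝ)
    (hG : ∀ n ω, IsL2Boosting γ (Finset.Ico (n / 2) n) (fun s => X n s ω)
      (fun s => signal (μ n) (Ψ n) (β n) (X n s ω) + ε n s ω) (φhat n ω) (G n ω))
    -- stopping at `k_n = ⌊C log n⌋`
    (C : ℝ) (hC0 : 0 < C) (hC : C < (ξ / 2 - ϑ) / (2 * Real.log 3)) :
    ∀ δ : ℝ, 0 < δ → Tendsto
      (fun n : ℕ => P {ω | ENNReal.ofReal δ ≤
        eLpNorm (fun x => G n ω ⌊C * Real.log n⌋₊ x - signal (μ n) (Ψ n) (β n) x) 2 (μ n)})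
      atTop (𝓝 0) := by
  intro δ hδ
  obtain ⟨K, hK⟩ := hs
  obtain ⟨M₀, hM₀⟩ := hb1
  obtain ⟨c₀, -, hpO⟩ := hb2
  obtain ⟨c, hc, hdet⟩ := hb3
  obtain ⟨B₀, hγB₀, hB₀⟩ := hγ
  obtain ⟨M, hM, hM1⟩ : ∃ M, M = max M₀ 1 ∧ 1 ≤ M := ⟨_, rfl, le_max_right _ _⟩
  obtain ⟨B, hB, hB0, hγB⟩ : ∃ B, (∀ n v, ∫ x, hofdBasis (μ n) (Ψ n) v x ^ 2 ∂(μ n) ≤ B) ∧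
      0 ≤ B ∧ γ * B < 2 := by
    refine ⟨max B₀ 0, fun n v => (hB₀ n v).trans (le_max_left _ _), le_max_right _ _, ?_⟩
    rcases max_cases B₀ 0 with h | h <;> rw [h.1] <;> linarith
  have hMbd : ∀ n i (l : Fin L), ∀ᵐ x ∂(μ n), |phiOne (Ψ n) i l x| ≤ M := fun n i l => by
    filter_upwards [hM₀ n i l] with x hx using hx.trans (hM ▸ le_max_left _ _)
  have hbdd : ∀ n, ∀ᵐ x ∂(μ n), FirstOrderBdd (Ψ n) M x := fun n => ae_firstOrderBdd (hMbd n)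
  set Λ : ℝ := (L + L : ℕ) * ((L + L).factorial * (M ^ 2) ^ (L + L)) / c with hΛ
  have hΛ0 : 0 ≤ Λ := by positivity
  have hg : ∀ n : ℕ, 1 ≤ n → GramBdd (μ n) (Ψ n) M (Λ * (n : ℝ) ^ ϑ) := fun n hn => by
    have hn0 : (0 : ℝ) < n := by exact_mod_cast hn
    have h := gramBdd_of_le_det hM1 (hΨ n) (hMbd n) (κ := c * (n : ℝ) ^ (-ϑ)) (by positivity)
      (hdet n hn)
    rwa [Real.rpow_neg hn0.le, ← div_div, div_inv_eq_mul] at h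
  obtain ⟨ρ, hρ⟩ : ∃ ρ, ρ = ξ / 2 - ϑ := ⟨_, rfl⟩
  have hρ0 : 0 < ρ := by linarith
  have hq4 : 4 ≤ q := by
    have : 4 ≤ 4 / ξ := by rw [le_div_iff₀ hξ0]; linarith
    linarith
  have hqξ : 1 < q * (ξ / 4) := by
    rw [div_lt_iff₀ hξ0] at hq; linarith
  have hI₁ : ∀ n : ℕ, ∀ r ∈ Finset.range (n / 2), r < n := fun n r hr => by
    have := Finset.mem_range.1 hr; omega
  have hI₂ : ∀ n : ℕ, ∀ r ∈ Finset.Ico (n / 2) n, r < n := fun n r hr => (Finset.mem_Ico.1 hr).2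
  have hc₁ : ∀ᶠ n : ℕ in atTop, (n : ℝ) / 4 ≤ (Finset.range (n / 2)).card := by
    filter_upwards [eventually_ge_atTop 2] with n hn
    rw [Finset.card_range, div_le_iff₀ (by norm_num)]
    have : n ≤ n / 2 * 4 := by omega
    exact_mod_cast this
  have hc₂ : ∀ᶠ n : ℕ in atTop, (n : ℝ) / 4 ≤ (Finset.Ico (n / 2) n).card := by
    filter_upwards [eventually_ge_atTop 2] with n hn
    rw [Nat.card_Ico, div_le_iff₀ (by norm_num)]
    have : n ≤ (n - n / 2) * 4 := by omega
    exact_mod_cast this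
  have hlawX : ∀ n r, r < n → HasLaw (X n r) (μ n) P := fun n r hr =>
    HasLaw.fun_comp (Y := Prod.fst) ⟨measurable_fst.aemeasurable, by
      rw [Measure.map_fst_prod]; simp⟩ (hlaw n r hr)
  have hindepX : ∀ n, iIndepFun (fun (r : Fin n) ω => X n r ω) P := fun n =>
    (hindep n).comp (fun _ => Prod.fst) fun _ => measurable_fst
  have hdict := withHighProb_dictDev (η := ρ / 4) hL hp hbdd hΨ hg hB hM1 hΛ0 hB0 hξ1 hϑ0
    (by linarith) (by linarith) hpO hlawX hindepX hI₁ hc₁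
  -- Truncation at `n ^ (ξ / 4)` is the point where `q > 4 / ξ` is needed.
  have hboost := withHighProb_boostDev (η := ρ / 4) (τ := ξ / 4) hL hp hbdd hΨ hg hB hM1 hΛ0 hB0
    hξ1 hϑ0 (by linarith) (by linarith) (by linarith) hqξ (by linarith) hνq hpO hlaw hindep hI₂ hc₂
  -- The midpoint of `B` and `2 / γ`.
  obtain ⟨B', hBB', hγB'⟩ : ∃ B', B < B' ∧ γ * B' < 2 := by
    refine ⟨(B + 2 / γ) / 2, ?_, ?_⟩
    · have : B < 2 / γ := by rw [lt_div_iff₀ hγ0]; linarith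
      linarith
    · have : γ * ((B + 2 / γ) / 2) = (γ * B + 2) / 2 := by field_simp
      linarith
  -- Accuracy `δ / 2` leaves the strict inequality that the complementary event requires.
  obtain ⟨N, η, hη, H⟩ := eLpNorm_boosting_sub_signal_le (K := max K 0) hγ0 hγB'
    (le_max_right _ _) hB0 (half_pos hδ)
  -- The dictionary error is at most `Cz * n ^ (-(3 * ρ / 4))`: the first term carries the factor `n
  -- ^ ϑ` of the inverse Gram matrix, and the final `1` absorbs the additive deviation.
  set Cz : ℝ := 2 * (2 * L * (2 * Λ * (1 + M ^ 2)) * M) + 1 with hCz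
  have hCz0 : 0 ≤ Cz := by positivity
  have hu : Tendsto (fun n : ℕ => (n : ℝ) ^ (-(3 * ρ / 4))) atTop (𝓝 0) :=
    tendsto_natCast_rpow_neg (by linarith)
  -- The dictionary error times the bound `n ^ (ρ / 4)` on the mean absolute noise is of order `n ^
  -- (-(ρ / 2))`, which dominates the other errors and beats the logarithmic number of steps.
  have hklog : Tendsto (fun n : ℕ => (1 + Cz * (9 + 4 * B))
      * ((n : ℝ) ^ (-(ρ / 2)) * (1 + C * Real.log n))) atTop (𝓝 0) := by
    have h1 : Tendsto (fun n : ℕ => (n : ℝ) ^ (-(ρ / 2))) atTop (𝓝 0) :=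
      tendsto_natCast_rpow_neg (by linarith)
    have h2 : Tendsto (fun n : ℕ => Real.log n / (n : ℝ) ^ (ρ / 2)) atTop (𝓝 0) :=
      ((isLittleO_log_rpow_atTop (by linarith : 0 < ρ / 2)).tendsto_div_nhds_zero).comp
        (tendsto_natCast_atTop_atTop (R := ℝ))
    have h3 := (h1.add (h2.const_mul C)).const_mul (1 + Cz * (9 + 4 * B))
    rw [mul_zero, add_zero, mul_zero] at h3
    refine h3.congr fun n => ?_
    rw [Real.rpow_neg (Nat.cast_nonneg n)]
    ring
  have hktop : Tendsto (fun n : ℕ => ⌊C * Real.log n⌋₊) atTop atTop :=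
    tendsto_nat_floor_atTop.comp ((Real.tendsto_log_atTop.comp
      (tendsto_natCast_atTop_atTop (R := ℝ))).const_mul_atTop hC0)
  suffices hmain : WithHighProb P fun n ω => eLpNorm (fun x => G n ω ⌊C * Real.log n⌋₊ x
      - signal (μ n) (Ψ n) (β n) x) 2 (μ n) < ENNReal.ofReal δ by
    simpa only [WithHighProb, not_lt] using hmain
  refine (hdict.and hboost).mono ?_
  have hev1 := (hu.const_mul (Λ * (L + L : ℕ))).eventually_le_const
    (by rw [mul_zero]; norm_num : Λ * (L + L : ℕ) * 0 < 1 / 2)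
  have hev2 := (hu.const_mul Cz).eventually_le_const
    (by rw [mul_zero]; norm_num : Cz * 0 < 1)
  have hev3 := ((hu.const_mul Cz).mul_const (3 + 2 * B)).eventually_le_const
    (by rw [mul_zero, zero_mul]; linarith : Cz * 0 * (3 + 2 * B) < B' - B)
  have hev4 := hklog.eventually_le_const hη
  filter_upwards [eventually_ge_atTop 2, hev1, hev2, hev3, hev4, hktop.eventually_ge_atTop N]
    with n hn h1 h2 h3 h4 h5 ω h
  obtain ⟨hd, hb⟩ := h
  have hn1 : (1 : ℝ) ≤ n := by exact_mod_cast (by omega : 1 ≤ n)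
  have hn0 : (0 : ℝ) < n := by linarith
  have e1 : (n : ℝ) ^ ϑ * (n : ℝ) ^ (-ξ / 2 + ρ / 4) = (n : ℝ) ^ (-(3 * ρ / 4)) := by
    rw [← Real.rpow_add hn0, hρ]; ring_nf
  have e2 : (n : ℝ) ^ (ϑ - ξ / 2 + ρ / 4) = (n : ℝ) ^ (-(3 * ρ / 4)) := by
    rw [hρ]; ring_nf
  have e3 : (n : ℝ) ^ (-ξ / 2 + ρ / 4) ≤ (n : ℝ) ^ (-(3 * ρ / 4)) :=
    Real.rpow_le_rpow_of_exponent_le hn1 (by linarith)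
  have e4 : (n : ℝ) ^ (-(3 * ρ / 4)) * (n : ℝ) ^ (ρ / 4) = (n : ℝ) ^ (-(ρ / 2)) := by
    rw [← Real.rpow_add hn0]; ring_nf
  have e5 : (n : ℝ) ^ (-(3 * ρ / 4)) ≤ (n : ℝ) ^ (-(ρ / 2)) :=
    Real.rpow_le_rpow_of_exponent_le hn1 (by linarith)
  have hu0 : 0 ≤ (n : ℝ) ^ (-(3 * ρ / 4)) := by positivity
  set u : ℝ := (n : ℝ) ^ (-(3 * ρ / 4)) with hu_def
  set t₁ : ℝ := (n : ℝ) ^ (-ξ / 2 + ρ / 4) with ht₁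
  have ht₁0 : 0 ≤ t₁ := by positivity
  rw [e2] at hb
  have hk1 : (⌊C * Real.log n⌋₊ : ℝ) ≤ C * Real.log n :=
    Nat.floor_le (mul_nonneg hC0.le (Real.log_nonneg hn1))
  have hlog : 0 ≤ C * Real.log n := mul_nonneg hC0.le (Real.log_nonneg hn1)
  have hfin := H (p n) L (μ n) (Ψ n) M (Λ * (n : ℝ) ^ ϑ) u ((n : ℝ) ^ (ρ / 4)) (Cz * u)
    (Finset.Ico (n / 2) n) (fun r => X n r ω) (fun r => ε n r ω) (β n) (φhat n ω) (G n ω)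
    ⌊C * Real.log n⌋₊ (hg n (by omega)) (by rw [Nat.card_Ico]; omega) (hB n)
    ((hK n).trans (le_max_left _ _)) hb (fun v => (hφhat n ω).aestronglyMeasurable (hΨ n) v)
    (fun v y hy => by
      refine ((hg n (by omega)).abs_sub_hofdBasis_le (by rw [Finset.card_range]; omega) ht₁0 ?_ hd
        (hφhat n ω) v hy).trans ?_
      · calc Λ * (n : ℝ) ^ ϑ * ((L + L : ℕ) * t₁) = Λ * (L + L : ℕ) * ((n : ℝ) ^ ϑ * t₁) := by ring
          _ ≤ 1 / 2 := by rw [e1]; exact h1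
      · calc 2 * (2 * L * (2 * (Λ * (n : ℝ) ^ ϑ) * (t₁ + M ^ 2 * t₁)) * M) + t₁
            = 2 * (2 * L * (2 * Λ * (1 + M ^ 2)) * M) * ((n : ℝ) ^ ϑ * t₁) + t₁ := by ring
          _ ≤ Cz * u := by rw [e1, hCz, add_mul, one_mul]; gcongr)
    (hG n ω) (by positivity) h2 hu0
    (Real.rpow_le_one_of_one_le_of_nonpos hn1 (by linarith)) (by positivity) (by linarith) h5
    (by
      refine le_trans ?_ h4
      calc (u + Cz * u * (8 + 4 * B + (n : ℝ) ^ (ρ / 4))) * (1 + (⌊C * Real.log n⌋₊ : ℝ))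
          = (u + Cz * (8 + 4 * B) * u + Cz * (u * (n : ℝ) ^ (ρ / 4)))
            * (1 + (⌊C * Real.log n⌋₊ : ℝ)) := by ring
        _ ≤ ((n : ℝ) ^ (-(ρ / 2)) + Cz * (8 + 4 * B) * (n : ℝ) ^ (-(ρ / 2))
            + Cz * (n : ℝ) ^ (-(ρ / 2))) * (1 + C * Real.log n) := by
            rw [e4]; gcongr
        _ = _ := by ring)
  exact hfin.trans_lt (by
    rw [ENNReal.ofReal_lt_ofReal_iff hδ]; linarith)
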